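/- Consider the triangular lattice of the plane, tiled by congruent closed equilateral triangles (tiles) each having a horizontal edge: *up-triangles* have it at the base, *down-triangles* on top. A *polyiamond* is a nonempty finite set $A$ of tiles that is connected through shared edges; $|A|$ is its number of tiles. Its *dual graph* has the tiles of $A$ as vertices, two of them adjacent if they share an edge. A *hole* of $A$ is a bounded connected component of the complement in the plane of the union of its tiles, $h(A)$ is the number of holes, and the *area* of a hole is the number of tiles that fill it. The *perimeter* of $A$ is the number of edges lying on the topological boundary of $A$; the *outer perimeter* $p_{out}(A)$ is the number of those edges that do not bound a hole. Let $p_{\min}(n)$ be the minimum perimeter of a polyiamond with $n$ tiles, and put $$h_k=3\binom{k}{2},\qquad n_k=\tfrac92k^2+\tfrac32k-2 .$$ Let $\mathrm{Hex}_k$ be the regular hexagon of side length $k$ made of tiles and centred at a fixed lattice point, with two horizontal sides, let $L_k=\mathrm{Hex}_k\setminus \mathrm{Hex}_{k-1}$ be its outermost layer, and let $C_k$ be the two tiles of $L_k$ that contain the bottom right corner point of $\mathrm{Hex}_k$. For $k\in\{2,3\}$ call a polyiamond $S$ a *central configuration of order $k$* if $L_k\setminus C_k\subseteq S\subseteq \mathrm{Hex}_k\setminus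 C_k$, $|S|=n_k$ and $h(S)=h_k$. Given central configurations $Spir_2$ and $Spir_3$ of orders 2 and 3, the spiral polyiamonds $Spir_k$, $k\ge 4$, are defined recursively: start from $Spir_{k-2}$; add the tiles of $C_{k-2}$, all down-triangles of $L_{k-1}$, and all tiles of $L_k\setminus C_k$; finally remove the penultimate up-triangle (from left to right) of the bottom row of $L_{k-2}$ and add instead the penultimate up-triangle of the bottom row of $L_{k-1}$. **Theorem.** Central configurations of orders 2 and 3 exist. For every choice of them and every $k>1$, $Spir_k$ is a polyiamond with $n_k$ tiles and $h_k$ holes, and: (1) the dual graph of $Spir_k$ is a tree; (2) every hole of $Spir_k$ has area 1; (3) $p_{out}(Spir_k)=p_{\min}(n_k+h_k)$, where $n_k+h_k=|Spir_k|+h(Spir_k)$. -/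

import Mathlib

namespace Polyiamond

/-! ### Tiles of the triangular lattice -/

/-- The point `a + b ω` of the triangular lattice, where `ω = exp (π i / 3)`. -/
noncomputable def latticePoint (v : ℤ × ℤ) : ℂ :=
  (v.1 : ℂ) + (v.2 : ℂ) * (1 / 2 + (Real.sqrt 3 / 2 : ℝ) * Complex.I)

/-- The tile `(a, b, true)` is the up-triangle with vertices `a + bω`, `(a+1) + bω`, `a + (b+1)ω`;
the tile `(a, b, false)` is the down-triangle with vertices
`(a+1) + bω`, `(a+1) + (b+1)ω`, `a + (b+1)ω`. -/
abbrev Tile := ℤ × ℤ × Bool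

/-- Up-triangles have their horizontal edge at the base. -/
def Tile.IsUp (t : Tile) : Prop := t.2.2 = true

/-- Down-triangles have their horizontal edge on top. -/
def Tile.IsDown (t : Tile) : Prop := t.2.2 = false

instance : DecidablePred Tile.IsUp := fun t => inferInstanceAs (Decidable (t.2.2 = true))
instance : DecidablePred Tile.IsDown := fun t => inferInstanceAs (Decidable (t.2.2 = false))

/-- The three vertices of a tile, in lattice coordinates. -/
def Tile.verts : Tile → Finset (ℤ × ℤ)
  | (a, b, true) => {(a, b), (a + 1, b), (a, b + 1)}
  | (a, b, false) => {(a + 1, b), (a + 1, b + 1), (a, b + 1)}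

/-- The three edges of a tile; an edge is recorded as the set of its two end points. -/
def Tile.edges (t : Tile) : Finset (Finset (ℤ × ℤ)) := t.verts.powersetCard 2

/-- The closed convex region of the plane spanned by a set of lattice points
(a closed triangle for `t.verts`, a closed segment for an edge). -/
def shape (s : Finset (ℤ × ℤ)) : Set ℂ := convexHull ℝ (latticePoint '' (s : Set (ℤ × ℤ)))

/-- The subset of the plane covered by the (closed) tiles of `A`. -/
def region (A : Finset Tile) : Set ℂ := ⋃ t ∈ A, shape t.verts

/-! ### Polyiamonds, holes and perimeters -/

/-- The dual graph: the vertices are the tiles of `A`, two distinct tiles being adjacent when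
they share an edge. -/
def dualGraph (A : Finset Tile) : SimpleGraph {t : Tile // t ∈ A} where
  Adj s t := s ≠ t ∧ ∃ e, e ∈ s.1.edges ∧ e ∈ t.1.edges
  symm := ⟨fun _ _ h => ⟨h.1.symm, h.2.imp fun _ he => ⟨he.2, he.1⟩⟩⟩
  loopless := ⟨fun _ h => h.1 rfl⟩

/-- A finite set of tiles is a polyiamond if it is nonempty and its tiles are glued together along
edges, i.e. any two of them are joined by a chain of tiles in which neighbours share an edge. -/
def IsPolyiamond (A : Finset Tile) : Prop := (dualGraph A).Connected

/-- The holes of `A`: the bounded connected components of the complement of `A` in the plane. -/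
def holes (A : Finset Tile) : Set (Set ℂ) :=
  {H | ∃ x ∈ (region A)ᶜ, H = connectedComponentIn (region A)ᶜ x ∧ Bornology.IsBounded H}

/-- The number of holes of `A`. -/
noncomputable def numHoles (A : Finset Tile) : ℕ := (holes A).ncard

/-- The area of a hole: the number of tiles that fill it. -/
noncomputable def holeArea (H : Set ℂ) : ℕ := {t : Tile | interior (shape t.verts) ⊆ H}.ncard

/-- The perimeter edges of `A`: the edges (of its tiles) on the topological boundary of `A`. -/
def perimeterEdges (A : Finset Tile) : Set (Finset (ℤ × ℤ)) :=
  {e | (∃ t ∈ A, e ∈ t.edges) ∧ shape e ⊆ frontier (region A)}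

/-- The perimeter of `A`. -/
noncomputable def perimeter (A : Finset Tile) : ℕ := (perimeterEdges A).ncard

/-- The outer perimeter of `A`: the number of perimeter edges that do not bound a hole. -/
noncomputable def outerPerimeter (A : Finset Tile) : ℕ :=
  {e ∈ perimeterEdges A | ¬ ∃ H ∈ holes A, shape e ⊆ frontier H}.ncard

/-- The perimeters of all polyiamonds with `n` tiles. -/
def perimeters (n : ℕ) : Set ℕ :=
  {p | ∃ A : Finset Tile, IsPolyiamond A ∧ A.card = n ∧ perimeter A = p}

/-! ### Hexagons and their layers -/

/-- The tiles of the regular hexagon of side length `k` centred at the origin; its corners are the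
points `± k`, `± k ω`, `± k ω²`. -/
noncomputable def hexagon (k : ℕ) : Finset Tile :=
  (Finset.Icc (-(k : ℤ)) k ×ˢ Finset.Icc (-(k : ℤ)) k ×ˢ Finset.univ).filter fun t =>
    ∀ v ∈ Tile.verts t, (-(k : ℤ) ≤ v.1 ∧ v.1 ≤ k) ∧ (-(k : ℤ) ≤ v.2 ∧ v.2 ≤ k) ∧
      (-(k : ℤ) ≤ v.1 + v.2 ∧ v.1 + v.2 ≤ k)

/-- The `k`-th hexagonal layer (for `k ≥ 1`). -/
noncomputable def layer (k : ℕ) : Finset Tile := hexagon k \ hexagon (k - 1)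

/-- The two tiles of the `k`-th layer in its bottom right corner, i.e. those that contain the
bottom right corner point `k - k ω` of the hexagon of side length `k`. -/
noncomputable def corner (k : ℕ) : Finset Tile :=
  (layer k).filter fun t => ((k : ℤ), -(k : ℤ)) ∈ Tile.verts t

/-- The penultimate up-triangle, from left to right, in the bottom row of the `m`-th layer
(for `m ≥ 2`). The up-triangles of that row are `(a, -m, true)` with `0 ≤ a ≤ m - 1`. -/
def penultimateUp (m : ℕ) : Tile := ((m : ℤ) - 2, -(m : ℤ), true)

/-! ### The spiral polyiamonds -/

/-- The number `n_k = (9/2) k² + (3/2) k - 2` (the division is exact). -/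
def nSeq (k : ℕ) : ℕ := (9 * k ^ 2 + 3 * k) / 2 - 2

/-- The number `h_k = 3 (k choose 2)`. -/
def hSeq (k : ℕ) : ℕ := 3 * k.choose 2

/-- Possible central configurations of the spirals (used for `k = 2` and `k = 3`): polyiamonds
inside the hexagon of side length `k` without its two bottom right corner tiles, which contain all
other tiles of the outermost layer and have `n_k` tiles and `h_k` holes. -/
structure IsCentral (k : ℕ) (S : Finset Tile) : Prop where
  polyiamond : IsPolyiamond S
  subset : S ⊆ hexagon k \ corner k
  layer_subset : layer k \ corner k ⊆ S
  card_eq : S.card = nSeq k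
  numHoles_eq : numHoles S = hSeq k

/-- A central configuration with 19 tiles and 3 holes. -/
noncomputable def centralTwo : Finset Tile :=
  hexagon 2 \ (corner 2 ∪ {(0, 0, true), (-1, 0, true), (0, -1, true)})

/-- A central configuration with 43 tiles and 9 holes. -/
noncomputable def centralThree : Finset Tile :=
  hexagon 3 \ (corner 3 ∪
    {(-2, 0, true), (-2, 1, true), (-1, -1, true), (-1, 1, true), (0, -2, true), (0, 0, true),
      (0, 1, true), (1, -2, true), (1, -1, false)})

/-- The spiral polyiamonds with central configurations `S₂` and `S₃`. For `k ≥ 4`, start with the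
spiral of index `k - 2`, add the two tiles in the bottom right corner of layer `k - 2`, all
down-triangles of layer `k - 1`, and all of layer `k` except the two tiles in its bottom right
corner; then move the penultimate up-triangle in the bottom row of layer `k - 2` to the penultimate
up-space in the bottom row of layer `k - 1`. (The values at `0` and `1` are irrelevant.) -/
noncomputable def spir (S₂ S₃ : Finset Tile) : ℕ → Finset Tile
  | 0 => ∅
  | 1 => ∅
  | 2 => S₂
  | 3 => S₃
  | k + 4 =>
    insert (penultimateUp (k + 3))
      ((spir S₂ S₃ (k + 2) ∪ corner (k + 2) ∪ (layer (k + 3)).filter Tile.IsDown ∪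
        (layer (k + 4) \ corner (k + 4))).erase (penultimateUp (k + 2)))

end Polyiamond

namespace Polyiamond

/-! ### Tile coordinates and neighbours -/

/-! Everything follows from one invariant, `IsSpiralLike`: the polyiamond is `filled k`, the hexagon
of side `k` without its corner, minus `h_k` pairwise non-adjacent inner tiles.

Holes: `filled k` lies in a set star-shaped about the origin that misses the centres of all other
tiles, so those tiles are in unbounded components of the complement (`not_isBounded_tileComponent`).
A missing tile whose three neighbours are present is a component by itself
(`tileComponent_eq_openTile`). So the holes are exactly the missing tiles, each of area 1, and there
are `(6k² - 2) - n_k = h_k` of them.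

Tree: counting pairs of a tile and a direction gives `2E + p = 3n` for the number `E` of dual edges.
The perimeter is `p = 3h_k + 6k = n_k + 2`, hence `E = n_k - 1`, and a connected graph with that
many edges is a tree.

Outer perimeter: it equals the perimeter `6k` of `filled k`, which has `6k² - 2` tiles. This is
optimal by the isoperimetric inequality `6n ≤ p² + 3` (`IsPolyiamond.six_mul_card_le`). If a
polyiamond meets `r_d` rows in direction `d`, each row has two boundary edges at its ends, whence `p
≥ r_0 + r_1 + r_2`; and a set of tiles with these widths has at most `((r_0 + r_1 + r_2)² + 3) / 6`
elements.

It remains to establish the invariant. For central configurations, isolation of the missing tiles is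
forced by the number of holes. In the recursion (`IsSpiralLike.spirStep`) the delicate point is
connectivity: the corner tiles close a layer to a ring, removing the penultimate up-triangle opens
the ring elsewhere, and the triangle added in its place is the bridge to the new outer layer. -/

/-- The three coordinates of a tile: it is cut out by `tc d t ≤ co d z ≤ tc d t + 1`. -/
def tc : Fin 3 → Tile → ℤ
  | 0, (a, _, _) => a
  | 1, (_, b, _) => b
  | 2, (a, b, true) => -a - b - 1
  | 2, (a, b, false) => -a - b - 2

/-- The neighbour of a tile that differs from it in the coordinate `d`. -/
def nbr : Fin 3 → Tile → Tile
  | 0, (a, b, true) => (a - 1, b, false)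
  | 0, (a, b, false) => (a + 1, b, true)
  | 1, (a, b, true) => (a, b - 1, false)
  | 1, (a, b, false) => (a, b + 1, true)
  | 2, (a, b, true) => (a, b, false)
  | 2, (a, b, false) => (a, b, true)

/-- The edge shared by `t` and `nbr d t`. -/
def edge : Fin 3 → Tile → Finset (ℤ × ℤ)
  | 0, (a, b, true) => {(a, b), (a, b + 1)}
  | 0, (a, b, false) => {(a + 1, b), (a + 1, b + 1)}
  | 1, (a, b, true) => {(a, b), (a + 1, b)}
  | 1, (a, b, false) => {(a, b + 1), (a + 1, b + 1)}
  | 2, (a, b, _) => {(a + 1, b), (a, b + 1)}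

@[simp] lemma tc_zero (a b : ℤ) (u : Bool) : tc 0 (a, b, u) = a := rfl
@[simp] lemma tc_one (a b : ℤ) (u : Bool) : tc 1 (a, b, u) = b := rfl
@[simp] lemma tc_two_up (a b : ℤ) : tc 2 (a, b, true) = -a - b - 1 := rfl
@[simp] lemma tc_two_down (a b : ℤ) : tc 2 (a, b, false) = -a - b - 2 := rfl
@[simp] lemma nbr_zero_up (a b : ℤ) : nbr 0 (a, b, true) = (a - 1, b, false) := rfl
@[simp] lemma nbr_zero_down (a b : ℤ) : nbr 0 (a, b, false) = (a + 1, b, true) := rfl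
@[simp] lemma nbr_one_up (a b : ℤ) : nbr 1 (a, b, true) = (a, b - 1, false) := rfl
@[simp] lemma nbr_one_down (a b : ℤ) : nbr 1 (a, b, false) = (a, b + 1, true) := rfl
@[simp] lemma nbr_two_up (a b : ℤ) : nbr 2 (a, b, true) = (a, b, false) := rfl
@[simp] lemma nbr_two_down (a b : ℤ) : nbr 2 (a, b, false) = (a, b, true) := rfl

lemma nbr_nbr (d : Fin 3) (t : Tile) : nbr d (nbr d t) = t := by
  obtain ⟨a, b, u⟩ := t
  fin_cases d <;> cases u <;> simp

lemma nbr_ne (d : Fin 3) (t : Tile) : nbr d t ≠ t := by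
  obtain ⟨a, b, u⟩ := t
  fin_cases d <;> cases u <;> simp

lemma nbr_inj {d d' : Fin 3} {t : Tile} (h : nbr d t = nbr d' t) : d = d' := by
  obtain ⟨a, b, u⟩ := t
  fin_cases d <;> fin_cases d' <;> cases u <;> simp at h ⊢ <;> omega

lemma nbr_left_injective (d : Fin 3) : Function.Injective (nbr d) := fun s t h => by
  rw [← nbr_nbr d s, h, nbr_nbr]

lemma edge_nbr (d : Fin 3) (t : Tile) : edge d (nbr d t) = edge d t := by
  obtain ⟨a, b, u⟩ := t
  fin_cases d <;> cases u <;> simp [edge]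

lemma edge_subset_verts (d : Fin 3) (t : Tile) : edge d t ⊆ t.verts := by
  obtain ⟨a, b, u⟩ := t
  fin_cases d <;> cases u <;> simp [edge, Tile.verts, Finset.insert_subset_iff]

lemma edge_subset_verts_nbr (d : Fin 3) (t : Tile) : edge d t ⊆ (nbr d t).verts :=
  edge_nbr d t ▸ edge_subset_verts d (nbr d t)

lemma eq_or_eq_of_edge_subset {d : Fin 3} {t s : Tile} (h : edge d t ⊆ s.verts) :
    s = t ∨ s = nbr d t := by
  obtain ⟨a, b, u⟩ := t
  obtain ⟨a', b', u'⟩ := s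
  fin_cases d <;> cases u <;> cases u' <;>
    simp [edge, Tile.verts, Finset.insert_subset_iff] at h ⊢ <;> omega

lemma mem_edges {e : Finset (ℤ × ℤ)} {t : Tile} : e ∈ t.edges ↔ ∃ d, e = edge d t := by
  constructor
  · intro h
    simp only [Tile.edges, Finset.mem_powersetCard] at h
    obtain ⟨hs, hc⟩ := h
    obtain ⟨x, y, hxy, rfl⟩ := Finset.card_eq_two.1 hc
    obtain ⟨a, b, u⟩ := t
    obtain ⟨x1, x2⟩ := x
    obtain ⟨y1, y2⟩ := y
    cases u <;> simp [Tile.verts, Finset.insert_subset_iff] at hs hxy <;>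
      obtain ⟨h1 | h1 | h1, h2 | h2 | h2⟩ := hs <;> obtain ⟨rfl, rfl⟩ := h1 <;>
      obtain ⟨rfl, rfl⟩ := h2 <;>
      first
        | (exfalso; simp at hxy; done)
        | (refine ⟨0, ?_⟩; simp [edge, Finset.pair_comm]; done)
        | (refine ⟨1, ?_⟩; simp [edge, Finset.pair_comm]; done)
        | (refine ⟨2, ?_⟩; simp [edge, Finset.pair_comm])
  · rintro ⟨d, rfl⟩
    simp only [Tile.edges, Finset.mem_powersetCard]
    refine ⟨edge_subset_verts d t, ?_⟩
    obtain ⟨a, b, u⟩ := t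
    fin_cases d <;> cases u <;> simp [edge]

lemma edge_mem_edges (d : Fin 3) (t : Tile) : edge d t ∈ t.edges := mem_edges.2 ⟨d, rfl⟩

lemma edge_inj {d d' : Fin 3} {t : Tile} (h : edge d t = edge d' t) : d = d' := by
  have := h ▸ edge_subset_verts_nbr d' t
  rcases eq_or_eq_of_edge_subset this with h' | h'
  · exact absurd h' (nbr_ne _ _)
  · exact (nbr_inj h').symm

lemma share_edge_iff {s t : Tile} :
    (s ≠ t ∧ ∃ e, e ∈ s.edges ∧ e ∈ t.edges) ↔ ∃ d, t = nbr d s := by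
  constructor
  · rintro ⟨hne, e, hs, ht⟩
    obtain ⟨d, rfl⟩ := mem_edges.1 hs
    rcases eq_or_eq_of_edge_subset (Finset.mem_powersetCard.1 ht).1 with h | h
    · exact absurd h.symm hne
    · exact ⟨d, h⟩
  · rintro ⟨d, rfl⟩
    exact ⟨(nbr_ne d s).symm, edge d s, edge_mem_edges d s, edge_nbr d s ▸ edge_mem_edges d _⟩

lemma dualGraph_adj {A : Finset Tile} {s t : {t : Tile // t ∈ A}} :
    (dualGraph A).Adj s t ↔ ∃ d, t.1 = nbr d s.1 := by
  rw [← share_edge_iff, ne_eq, ← Subtype.ext_iff]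
  rfl

lemma tc_nbr_of_ne {d e : Fin 3} (h : e ≠ d) (t : Tile) : tc e (nbr d t) = tc e t := by
  obtain ⟨a, b, u⟩ := t
  fin_cases d <;> fin_cases e <;> cases u <;> simp at h ⊢ <;> ring

/-- A tile is determined by its coordinates. -/
lemma tile_ext {s t : Tile} (h : ∀ d, tc d s = tc d t) : s = t := by
  have h0 := h 0
  have h1 := h 1
  have h2 := h 2
  obtain ⟨a, b, u⟩ := t
  obtain ⟨a', b', u'⟩ := s
  cases u <;> cases u' <;> simp at * <;> omega

lemma eq_or_eq_nbr_of_tc {d : Fin 3} {s t : Tile} (h : ∀ e, e ≠ d → tc e s = tc e t) :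
    s = t ∨ s = nbr d t := by
  have h0 := h 0
  have h1 := h 1
  have h2 := h 2
  obtain ⟨a, b, u⟩ := t
  obtain ⟨a', b', u'⟩ := s
  fin_cases d <;> cases u <;> cases u' <;> simp at * <;> omega

/-! ### Coordinates in the plane -/

/-- The three coordinates of a point of the plane; their sum vanishes. -/
noncomputable def co : Fin 3 → ℂ →L[ℝ] ℝ
  | 0 => Complex.reCLM - (1 / √3 : ℝ) • Complex.imCLM
  | 1 => (2 / √3 : ℝ) • Complex.imCLM
  | 2 => -Complex.reCLM - (1 / √3 : ℝ) • Complex.imCLM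

/-- The point with coordinates `x`, `y` and `- x - y`. -/
noncomputable def pt (x y : ℝ) : ℂ := (x : ℂ) + (y : ℂ) * (1 / 2 + (√3 / 2 : ℝ) * Complex.I)

lemma co_zero_pt (x y : ℝ) : co 0 (pt x y) = x := by
  have : √3 ≠ 0 := by positivity
  simp [co, pt]; field_simp; ring

lemma co_one_pt (x y : ℝ) : co 1 (pt x y) = y := by
  have : √3 ≠ 0 := by positivity
  simp [co, pt]; field_simp

lemma co_two (z : ℂ) : co 2 z = - co 0 z - co 1 z := by
  simp [co]; ring

lemma pt_co (z : ℂ) : pt (co 0 z) (co 1 z) = z := by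
  have : √3 ≠ 0 := by positivity
  apply Complex.ext <;> simp [co, pt] 
  · have h3 : √3 ^ 2 = 3 := Real.sq_sqrt (by norm_num)
    field_simp
    ring_nf
    rw [h3]
    ring
  · field_simp

lemma co_ext {z w : ℂ} (h0 : co 0 z = co 0 w) (h1 : co 1 z = co 1 w) : z = w := by
  rw [← pt_co z, h0, h1, pt_co]

lemma latticePoint_eq (v : ℤ × ℤ) : latticePoint v = pt v.1 v.2 := by
  simp [latticePoint, pt]

/-- The closed tile. -/
def closedTile (t : Tile) : Set ℂ := {z | ∀ d, (tc d t : ℝ) ≤ co d z ∧ co d z ≤ tc d t + 1}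

/-- The open tile. -/
def openTile (t : Tile) : Set ℂ := {z | ∀ d, (tc d t : ℝ) < co d z ∧ co d z < tc d t + 1}

lemma convex_closedTile (t : Tile) : Convex ℝ (closedTile t) := by
  have : closedTile t = ⋂ d, co d ⁻¹' Set.Icc (tc d t : ℝ) (tc d t + 1) := by
    ext z; simp [closedTile]
  rw [this]
  exact convex_iInter fun d => (convex_Icc _ _).linear_preimage (co d).toLinearMap

lemma convex_openTile (t : Tile) : Convex ℝ (openTile t) := by
  have : openTile t = ⋂ d, co d ⁻¹' Set.Ioo (tc d t : ℝ) (tc d t + 1) := by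
    ext z; simp [openTile]
  rw [this]
  exact convex_iInter fun d => (convex_Ioo _ _).linear_preimage (co d).toLinearMap

lemma isOpen_openTile (t : Tile) : IsOpen (openTile t) := by
  have : openTile t = ⋂ d, co d ⁻¹' Set.Ioo (tc d t : ℝ) (tc d t + 1) := by
    ext z; simp [openTile]
  rw [this]
  exact isOpen_iInter_of_finite fun d => isOpen_Ioo.preimage (co d).continuous

lemma isClosed_closedTile (t : Tile) : IsClosed (closedTile t) := by
  have : closedTile t = ⋂ d, co d ⁻¹' Set.Icc (tc d t : ℝ) (tc d t + 1) := by
    ext z; simp [closedTile]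
  rw [this]
  exact isClosed_iInter fun d => isClosed_Icc.preimage (co d).continuous

lemma openTile_subset_closedTile (t : Tile) : openTile t ⊆ closedTile t :=
  fun _ hz d => ⟨(hz d).1.le, (hz d).2.le⟩

lemma mem_closedTile {z : ℂ} {t : Tile} : z ∈ closedTile t ↔
    ((tc 0 t : ℝ) ≤ co 0 z ∧ co 0 z ≤ tc 0 t + 1) ∧ ((tc 1 t : ℝ) ≤ co 1 z ∧ co 1 z ≤ tc 1 t + 1) ∧
      ((tc 2 t : ℝ) ≤ - co 0 z - co 1 z ∧ - co 0 z - co 1 z ≤ tc 2 t + 1) := by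
  simp [closedTile, Fin.forall_fin_succ, co_two]

lemma mem_openTile {z : ℂ} {t : Tile} : z ∈ openTile t ↔
    ((tc 0 t : ℝ) < co 0 z ∧ co 0 z < tc 0 t + 1) ∧ ((tc 1 t : ℝ) < co 1 z ∧ co 1 z < tc 1 t + 1) ∧
      ((tc 2 t : ℝ) < - co 0 z - co 1 z ∧ - co 0 z - co 1 z < tc 2 t + 1) := by
  simp [openTile, Fin.forall_fin_succ, co_two]

lemma shape_verts (t : Tile) : shape t.verts = closedTile t := by
  apply Set.Subset.antisymm
  · refine convexHull_min ?_ (convex_closedTile t)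
    rintro _ ⟨v, hv, rfl⟩
    rw [mem_closedTile, latticePoint_eq, co_zero_pt, co_one_pt]
    obtain ⟨a, b, u⟩ := t
    obtain ⟨v1, v2⟩ := v
    cases u <;> simp [Tile.verts] at hv <;> rcases hv with ⟨rfl, rfl⟩ | ⟨rfl, rfl⟩ | ⟨rfl, rfl⟩ <;>
      simp <;> (try constructor) <;> linarith
  · intro z hz
    rw [mem_closedTile] at hz
    -- It suffices to give barycentric weights; those used below are the distances, in coordinates,
    -- of `z` from the three side lines.
    have key : ∀ (w : Fin 3 → ℝ) (p : Fin 3 → ℤ × ℤ), (∀ i, 0 ≤ w i) → ∑ i, w i = 1 →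
        (∀ i, p i ∈ t.verts) → z = ∑ i, w i • latticePoint (p i) → z ∈ shape t.verts := by
      intro w p hw h1 hp hz
      rw [hz]
      exact (convex_convexHull ℝ _).sum_mem (fun i _ => hw i) h1
        fun i _ => subset_convexHull ℝ _ ⟨p i, hp i, rfl⟩
    obtain ⟨a, b, u⟩ := t
    cases u
    · refine key ![b + 1 - co 1 z, co 0 z + co 1 z - a - b - 1, a + 1 - co 0 z]
        ![(a + 1, b), (a + 1, b + 1), (a, b + 1)] ?_ ?_ ?_ ?_
      · simp at hz
        intro i; fin_cases i <;> simp <;> linarith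
      · simp [Fin.sum_univ_three]; ring
      · intro i; fin_cases i <;> simp [Tile.verts]
      · apply co_ext <;> simp [Fin.sum_univ_three, latticePoint_eq, co_zero_pt, co_one_pt,
          -Complex.real_smul] <;> ring
    · refine key ![1 - (co 0 z - a) - (co 1 z - b), co 0 z - a, co 1 z - b]
        ![(a, b), (a + 1, b), (a, b + 1)] ?_ ?_ ?_ ?_
      · simp at hz
        intro i; fin_cases i <;> simp <;> linarith
      · simp [Fin.sum_univ_three]; ring
      · intro i; fin_cases i <;> simp [Tile.verts]
      · apply co_ext <;> simp [Fin.sum_univ_three, latticePoint_eq, co_zero_pt, co_one_pt,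
          -Complex.real_smul] <;> ring

/-- The centre of a tile. -/
noncomputable def center : Tile → ℂ
  | (a, b, true) => pt (a + 1 / 3) (b + 1 / 3)
  | (a, b, false) => pt (a + 2 / 3) (b + 2 / 3)

lemma center_mem (t : Tile) : center t ∈ openTile t := by
  rw [mem_openTile]
  obtain ⟨a, b, u⟩ := t
  cases u <;> simp only [center, co_zero_pt, co_one_pt] <;>
    simp only [tc_zero, tc_one, tc_two_up, tc_two_down] <;> push_cast <;>
    refine ⟨⟨?_, ?_⟩, ⟨?_, ?_⟩, ?_, ?_⟩ <;> linarith

lemma openTile_tc_eq {z : ℂ} {s t : Tile} {d : Fin 3}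
    (hs : (tc d s : ℝ) < co d z ∧ co d z < tc d s + 1)
    (ht : (tc d t : ℝ) ≤ co d z ∧ co d z ≤ tc d t + 1) : tc d s = tc d t := by
  have h1 : (tc d s : ℝ) < tc d t + 1 := by linarith
  have h2 : (tc d t : ℝ) < tc d s + 1 := by linarith
  norm_cast at h1 h2
  omega

lemma eq_of_mem_openTile_of_mem_closedTile {z : ℂ} {s t : Tile} (hs : z ∈ openTile s)
    (ht : z ∈ closedTile t) : s = t :=
  tile_ext fun d => openTile_tc_eq (hs d) (ht d)

lemma closedTile_subset_closure (t : Tile) : closedTile t ⊆ closure (openTile t) := by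
  intro z hz
  -- The defining inequalities are strict at the centre, so moving towards it from `z` enters the
  -- open tile at once.
  have h := segment_subset_closure_openSegment (𝕜 := ℝ) (left_mem_segment ℝ z (center t))
  refine closure_mono ?_ h
  rintro _ ⟨a, b, ha, hb, hab, rfl⟩ d
  have h1 := center_mem t d
  have h2 := hz d
  simp only [map_add, map_smul, smul_eq_mul]
  have ha' : a = 1 - b := by linarith
  subst ha'
  constructor <;> nlinarith

lemma exists_mem_closedTile (z : ℂ) : ∃ t, z ∈ closedTile t := by
  have h1 := Int.floor_le (co 0 z)
  have h2 := Int.lt_floor_add_one (co 0 z)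
  have h3 := Int.floor_le (co 1 z)
  have h4 := Int.lt_floor_add_one (co 1 z)
  -- The floors select a lattice rhombus; its diagonal separates the two tiles.
  by_cases h : co 0 z + co 1 z ≤ ⌊co 0 z⌋ + ⌊co 1 z⌋ + 1
  · refine ⟨(⌊co 0 z⌋, ⌊co 1 z⌋, true), ?_⟩
    rw [mem_closedTile]
    simp
    refine ⟨⟨?_, ?_⟩, ⟨?_, ?_⟩, ?_, ?_⟩ <;> linarith
  · refine ⟨(⌊co 0 z⌋, ⌊co 1 z⌋, false), ?_⟩
    rw [mem_closedTile]
    simp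
    refine ⟨⟨?_, ?_⟩, ⟨?_, ?_⟩, ?_, ?_⟩ <;> linarith

lemma exists_openTile_inter {U : Set ℂ} (hU : IsOpen U) {z : ℂ} (hz : z ∈ U) :
    ∃ t, ∃ y ∈ U, y ∈ openTile t := by
  obtain ⟨t, ht⟩ := exists_mem_closedTile z
  obtain ⟨y, hyU, hyt⟩ := mem_closure_iff.1 (closedTile_subset_closure t ht) U hU hz
  exact ⟨t, y, hyU, hyt⟩

/-- Some defining inequality is an equality, so the point is on a side, and the tile across that
side contains it. -/
lemma exists_mem_closedTile_nbr {z : ℂ} {t : Tile} (hz : z ∈ closedTile t) (h : z ∉ openTile t) :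
    ∃ d, z ∈ closedTile (nbr d t) := by
  rw [mem_closedTile] at hz
  rw [mem_openTile] at h
  by_contra! hc
  have h0 := hc 0
  have h1 := hc 1
  have h2 := hc 2
  rw [mem_closedTile] at h0 h1 h2
  apply h
  obtain ⟨a, b, u⟩ := t
  cases u <;> simp at * <;> refine ⟨⟨?_, ?_⟩, ⟨?_, ?_⟩, ?_, ?_⟩ <;> by_contra! hlt <;>
    first
      | (have := h0 (by linarith) (by linarith) (by linarith) (by linarith) (by linarith); linarith)
      | (have := h1 (by linarith) (by linarith) (by linarith) (by linarith) (by linarith); linarith)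
      | (have := h2 (by linarith) (by linarith) (by linarith) (by linarith) (by linarith); linarith)

lemma interior_closedTile (t : Tile) : interior (closedTile t) = openTile t := by
  apply Set.Subset.antisymm
  · intro z hz
    by_contra hn
    obtain ⟨d, hd⟩ := exists_mem_closedTile_nbr (interior_subset hz) hn
    obtain ⟨y, hy, hy'⟩ := mem_closure_iff.1 (closedTile_subset_closure _ hd) _ isOpen_interior hz
    exact nbr_ne d t (eq_of_mem_openTile_of_mem_closedTile hy' (interior_subset hy))
  · exact interior_maximal (openTile_subset_closedTile t) (isOpen_openTile t)

lemma closure_openTile (t : Tile) : closure (openTile t) = closedTile t :=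
  Set.Subset.antisymm (closure_minimal (openTile_subset_closedTile t) (isClosed_closedTile t))
    (closedTile_subset_closure t)

lemma isBounded_closedTile (t : Tile) : Bornology.IsBounded (closedTile t) := by
  rw [← shape_verts, shape, isBounded_convexHull]
  exact (t.verts.finite_toSet.image _).isBounded

/-! ### Edges in the plane -/

/-- The union of the interiors of `t`, of `nbr d t`, and of their common edge. -/
def openRhombus (d : Fin 3) (t : Tile) : Set ℂ :=
  {z | ∀ e, e ≠ d → (tc e t : ℝ) < co e z ∧ co e z < tc e t + 1}

lemma isOpen_openRhombus (d : Fin 3) (t : Tile) : IsOpen (openRhombus d t) := by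
  have : openRhombus d t = ⋂ e : {e // e ≠ d}, co e ⁻¹' Set.Ioo (tc e t : ℝ) (tc e t + 1) := by
    ext z; simp [openRhombus]
  rw [this]
  exact isOpen_iInter_of_finite fun e => isOpen_Ioo.preimage (co _).continuous

lemma convex_openRhombus (d : Fin 3) (t : Tile) : Convex ℝ (openRhombus d t) := by
  have : openRhombus d t = ⋂ e : {e // e ≠ d}, co e ⁻¹' Set.Ioo (tc e t : ℝ) (tc e t + 1) := by
    ext z; simp [openRhombus]
  rw [this]
  exact convex_iInter fun e => (convex_Ioo _ _).linear_preimage (co _).toLinearMap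

lemma openTile_subset_openRhombus (d : Fin 3) (t : Tile) : openTile t ⊆ openRhombus d t :=
  fun _ hz e _ => hz e

lemma openRhombus_nbr (d : Fin 3) (t : Tile) : openRhombus d (nbr d t) = openRhombus d t := by
  ext z
  simp only [openRhombus, Set.mem_ofPred_eq]
  refine forall₂_congr fun e he => by rw [tc_nbr_of_ne he]

lemma eq_or_eq_of_mem_openRhombus {d : Fin 3} {s t : Tile} {z : ℂ} (hz : z ∈ openRhombus d t)
    (hs : z ∈ closedTile s) : s = t ∨ s = nbr d t :=
  eq_or_eq_nbr_of_tc fun e he => (openTile_tc_eq (hz e he) (hs e)).symm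

lemma openRhombus_subset (d : Fin 3) (t : Tile) :
    openRhombus d t ⊆ closedTile t ∪ closedTile (nbr d t) := by
  intro z hz
  obtain ⟨s, hs⟩ := exists_mem_closedTile z
  rcases eq_or_eq_of_mem_openRhombus hz hs with rfl | rfl
  · exact Or.inl hs
  · exact Or.inr hs

lemma shape_edge_subset (d : Fin 3) (t : Tile) : shape (edge d t) ⊆ closedTile t := by
  rw [← shape_verts]
  exact convexHull_mono (Set.image_mono (Finset.coe_subset.2 (edge_subset_verts d t)))

lemma shape_edge_subset_nbr (d : Fin 3) (t : Tile) : shape (edge d t) ⊆ closedTile (nbr d t) :=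
  edge_nbr d t ▸ shape_edge_subset d (nbr d t)

lemma exists_mem_shape_edge (d : Fin 3) (t : Tile) : ∃ z ∈ shape (edge d t), z ∈ openRhombus d t := by
  have key : ∀ p q, p ∈ edge d t → q ∈ edge d t →
      (1 / 2 : ℝ) • latticePoint p + (1 / 2 : ℝ) • latticePoint q ∈ openRhombus d t →
      ∃ z ∈ shape (edge d t), z ∈ openRhombus d t := by
    intro p q hp hq h
    refine ⟨_, ?_, h⟩
    exact (convex_convexHull ℝ _) (subset_convexHull ℝ _ (Set.mem_image_of_mem _ hp))
      (subset_convexHull ℝ _ (Set.mem_image_of_mem _ hq)) (by norm_num) (by norm_num) (by norm_num)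
  obtain ⟨a, b, u⟩ := t
  fin_cases d <;> cases u
  · refine key (a + 1, b) (a + 1, b + 1) (by simp [edge]) (by simp [edge]) ?_
    simp [openRhombus, Fin.forall_fin_succ, latticePoint_eq, co_two, co_zero_pt,
      co_one_pt, -Complex.real_smul]
    refine ⟨⟨?_, ?_⟩, ?_, ?_⟩ <;> linarith
  · refine key (a, b) (a, b + 1) (by simp [edge]) (by simp [edge]) ?_
    simp [openRhombus, Fin.forall_fin_succ, latticePoint_eq, co_two, co_zero_pt,
      co_one_pt, -Complex.real_smul]
    refine ⟨⟨?_, ?_⟩, ?_, ?_⟩ <;> linarith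
  · refine key (a, b + 1) (a + 1, b + 1) (by simp [edge]) (by simp [edge]) ?_
    simp [openRhombus, Fin.forall_fin_succ, latticePoint_eq, co_two, co_zero_pt,
      co_one_pt, -Complex.real_smul]
    refine ⟨⟨?_, ?_⟩, ?_, ?_⟩ <;> linarith
  · refine key (a, b) (a + 1, b) (by simp [edge]) (by simp [edge]) ?_
    simp [openRhombus, Fin.forall_fin_succ, latticePoint_eq, co_two, co_zero_pt,
      co_one_pt, -Complex.real_smul]
    refine ⟨⟨?_, ?_⟩, ?_, ?_⟩ <;> linarith
  · refine key (a + 1, b) (a, b + 1) (by simp [edge]) (by simp [edge]) ?_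
    simp [openRhombus, Fin.forall_fin_succ, latticePoint_eq, co_two, co_zero_pt,
      co_one_pt, -Complex.real_smul]
    refine ⟨⟨?_, ?_⟩, ?_, ?_⟩ <;> linarith
  · refine key (a + 1, b) (a, b + 1) (by simp [edge]) (by simp [edge]) ?_
    simp [openRhombus, Fin.forall_fin_succ, latticePoint_eq, co_two, co_zero_pt,
      co_one_pt, -Complex.real_smul]
    refine ⟨⟨?_, ?_⟩, ?_, ?_⟩ <;> linarith

/-! ### Perimeter edges -/

lemma mem_region {A : Finset Tile} {z : ℂ} : z ∈ region A ↔ ∃ t ∈ A, z ∈ closedTile t := by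
  simp [region, shape_verts]

lemma isClosed_region (A : Finset Tile) : IsClosed (region A) := by
  have : region A = ⋃ t ∈ A, closedTile t := by simp only [region, shape_verts]
  rw [this]
  exact A.finite_toSet.isClosed_biUnion fun t _ => isClosed_closedTile t

lemma region_mono {A B : Finset Tile} (h : A ⊆ B) : region A ⊆ region B := by
  intro z hz
  obtain ⟨t, ht, hzt⟩ := mem_region.1 hz
  exact mem_region.2 ⟨t, h ht, hzt⟩

lemma notMem_region_of_mem_openTile {A : Finset Tile} {t : Tile} (ht : t ∉ A) {z : ℂ}
    (hz : z ∈ openTile t) : z ∉ region A := by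
  intro h
  obtain ⟨s, hs, hzs⟩ := mem_region.1 h
  exact ht (eq_of_mem_openTile_of_mem_closedTile hz hzs ▸ hs)

/-- If the neighbour is present, the open rhombus is a neighbourhood of an edge point inside the
region. If it is absent, its interior avoids the region and accumulates at every point of the edge.
-/
lemma shape_edge_subset_frontier {A : Finset Tile} {t : Tile} (ht : t ∈ A) (d : Fin 3) :
    shape (edge d t) ⊆ frontier (region A) ↔ nbr d t ∉ A := by
  constructor
  · intro h hn
    obtain ⟨z, hz, hzr⟩ := exists_mem_shape_edge d t
    have hsub : openRhombus d t ⊆ region A := by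
      intro w hw
      rcases openRhombus_subset d t hw with h | h
      · exact mem_region.2 ⟨t, ht, h⟩
      · exact mem_region.2 ⟨_, hn, h⟩
    exact (h hz).2 (interior_maximal hsub (isOpen_openRhombus d t) hzr)
  · intro hn z hz
    refine ⟨subset_closure (mem_region.2 ⟨t, ht, shape_edge_subset d t hz⟩), fun hi => ?_⟩
    obtain ⟨y, hy, hy'⟩ := mem_closure_iff.1 (closedTile_subset_closure _
      (shape_edge_subset_nbr d t hz)) _ isOpen_interior hi
    exact notMem_region_of_mem_openTile hn hy' (interior_subset hy)

/-- The pairs of a tile of `A` and a direction in which the neighbouring tile is not in `A`. -/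
def boundaryPairs (A : Finset Tile) : Finset (Tile × Fin 3) :=
  (A ×ˢ Finset.univ).filter fun p => nbr p.2 p.1 ∉ A

lemma mem_boundaryPairs {A : Finset Tile} {p : Tile × Fin 3} :
    p ∈ boundaryPairs A ↔ p.1 ∈ A ∧ nbr p.2 p.1 ∉ A := by
  simp [boundaryPairs]

lemma perimeterEdges_eq (A : Finset Tile) :
    perimeterEdges A = (fun p : Tile × Fin 3 => edge p.2 p.1) '' (boundaryPairs A) := by
  ext e
  constructor
  · rintro ⟨⟨t, ht, he⟩, hs⟩
    obtain ⟨d, rfl⟩ := mem_edges.1 he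
    exact ⟨(t, d), mem_boundaryPairs.2 ⟨ht, (shape_edge_subset_frontier ht d).1 hs⟩, rfl⟩
  · rintro ⟨⟨t, d⟩, hp, rfl⟩
    obtain ⟨ht, hn⟩ := mem_boundaryPairs.1 hp
    exact ⟨⟨t, ht, edge_mem_edges d t⟩, (shape_edge_subset_frontier ht d).2 hn⟩

/-- An edge lies in only two tiles, and for a boundary edge just one of them is in `A`. Perimeters
thereby become finite counts of pairs. -/
lemma injOn_edge (A : Finset Tile) :
    Set.InjOn (fun p : Tile × Fin 3 => edge p.2 p.1) (boundaryPairs A) := by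
  rintro ⟨t, d⟩ hp ⟨t', d'⟩ hp' h
  obtain ⟨ht, hn⟩ := mem_boundaryPairs.1 hp
  obtain ⟨ht', hn'⟩ := mem_boundaryPairs.1 hp'
  simp only at h ht hn ht' hn'
  obtain rfl : t' = t := by
    rcases eq_or_eq_of_edge_subset (h.trans_subset (edge_subset_verts d' t')) with h' | h'
    · exact h'
    · exact absurd (h' ▸ ht') hn
  rw [edge_inj h]

lemma perimeter_eq (A : Finset Tile) : perimeter A = (boundaryPairs A).card := by
  rw [perimeter, perimeterEdges_eq, (injOn_edge A).ncard_image, Set.ncard_coe_finset]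

/-! ### Components of the complement -/

/-- The component of the complement of `A` that contains the tile `t`. -/
noncomputable def tileComponent (A : Finset Tile) (t : Tile) : Set ℂ :=
  connectedComponentIn (region A)ᶜ (center t)

lemma openTile_subset_compl {A : Finset Tile} {t : Tile} (ht : t ∉ A) :
    openTile t ⊆ (region A)ᶜ := fun _ hz => notMem_region_of_mem_openTile ht hz

lemma openTile_subset_tileComponent {A : Finset Tile} {t : Tile} (ht : t ∉ A) :
    openTile t ⊆ tileComponent A t :=
  (convex_openTile t).isPreconnected.subset_connectedComponentIn (center_mem t)
    (openTile_subset_compl ht)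

/-- The open rhombus joins the two tiles inside the complement. -/
lemma tileComponent_nbr {A : Finset Tile} {t : Tile} {d : Fin 3} (ht : t ∉ A)
    (hn : nbr d t ∉ A) : tileComponent A (nbr d t) = tileComponent A t := by
  have hsub : openRhombus d t ⊆ (region A)ᶜ := by
    intro z hz h
    obtain ⟨s, hs, hzs⟩ := mem_region.1 h
    rcases eq_or_eq_of_mem_openRhombus hz hzs with rfl | rfl
    · exact ht hs
    · exact hn hs
  refine (connectedComponentIn_eq ?_).symm
  refine (convex_openRhombus d t).isPreconnected.subset_connectedComponentIn
    (openTile_subset_openRhombus d t (center_mem t)) hsub ?_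
  exact openRhombus_nbr d t ▸ openTile_subset_openRhombus d _ (center_mem (nbr d t))

/-- Components of an open set are open and tile interiors are dense, so every component meets the
interior of some tile. -/
lemma exists_eq_tileComponent {A : Finset Tile} {x : ℂ} (hx : x ∈ (region A)ᶜ) :
    ∃ t, t ∉ A ∧ connectedComponentIn (region A)ᶜ x = tileComponent A t := by
  have ho : IsOpen (connectedComponentIn (region A)ᶜ x) :=
    (isClosed_region A).isOpen_compl.connectedComponentIn
  obtain ⟨t, y, hy, hyt⟩ := exists_openTile_inter ho (mem_connectedComponentIn hx)
  have ht : t ∉ A := fun h => connectedComponentIn_subset _ _ hy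
    (mem_region.2 ⟨t, h, openTile_subset_closedTile t hyt⟩)
  refine ⟨t, ht, ?_⟩
  rw [connectedComponentIn_eq hy]
  exact (connectedComponentIn_eq (openTile_subset_tileComponent ht hyt)).symm

/-- The neighbours cover all boundary points of the tile, vertices included, so the open tile and
the exterior of the closed tile separate the complement. -/
lemma tileComponent_eq_openTile {A : Finset Tile} {t : Tile} (ht : t ∉ A)
    (hn : ∀ d, nbr d t ∈ A) : tileComponent A t = openTile t := by
  refine Set.Subset.antisymm ?_ (openTile_subset_tileComponent ht)
  refine IsPreconnected.subset_left_of_subset_union (isOpen_openTile t)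
    (isClosed_closedTile t).isOpen_compl ?_ ?_ ?_ isPreconnected_connectedComponentIn
  · exact Set.disjoint_compl_right_iff_subset.2 (openTile_subset_closedTile t)
  · intro z hz
    by_contra hc
    simp only [Set.mem_union, Set.mem_compl_iff, not_or, not_not] at hc
    obtain ⟨d, hd⟩ := exists_mem_closedTile_nbr hc.2 hc.1
    exact connectedComponentIn_subset _ _ hz (mem_region.2 ⟨_, hn d, hd⟩)
  · exact ⟨center t, mem_connectedComponentIn (openTile_subset_compl ht (center_mem t)),
      center_mem t⟩

/-- If all tiles outside the finite set `F` lie in unbounded components of the complement of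
`S ⊆ F`, then every hole of `S` is the component of a tile of `F \ S`. -/
lemma holes_subset {F S : Finset Tile}
    (hF : ∀ t, t ∉ F → ¬ Bornology.IsBounded (tileComponent S t)) :
    holes S ⊆ tileComponent S '' (F \ S : Finset Tile) := by
  rintro H ⟨x, hx, rfl, hb⟩
  obtain ⟨t, ht, h⟩ := exists_eq_tileComponent hx
  refine ⟨t, ?_, h.symm⟩
  have : t ∈ F := by
    by_contra htF
    exact hF t htF (h ▸ hb)
  simp [this, ht]

/-- Holes of area one: the tiles of `F \ S` have all their neighbours in `S`. -/
lemma holes_eq {F S : Finset Tile}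
    (hF : ∀ t, t ∉ F → ¬ Bornology.IsBounded (tileComponent S t))
    (hM : ∀ t ∈ F, t ∉ S → ∀ d, nbr d t ∈ S) :
    holes S = openTile '' (F \ S : Finset Tile) := by
  apply Set.Subset.antisymm
  · intro H hH
    obtain ⟨t, ht, rfl⟩ := holes_subset hF hH
    have h := Finset.mem_sdiff.1 (Finset.mem_coe.1 ht)
    exact ⟨t, ht, (tileComponent_eq_openTile h.2 (hM t h.1 h.2)).symm⟩
  · rintro _ ⟨t, ht, rfl⟩
    have h := Finset.mem_sdiff.1 (Finset.mem_coe.1 ht)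
    refine ⟨center t, openTile_subset_compl h.2 (center_mem t),
      (tileComponent_eq_openTile h.2 (hM t h.1 h.2)).symm, ?_⟩
    exact (isBounded_closedTile t).subset (openTile_subset_closedTile t)

lemma openTile_subset_iff {s t : Tile} : openTile s ⊆ openTile t ↔ s = t := by
  refine ⟨fun h => ?_, fun h => h ▸ subset_rfl⟩
  exact eq_of_mem_openTile_of_mem_closedTile (center_mem s)
    (openTile_subset_closedTile t (h (center_mem s)))

lemma openTile_injective : Function.Injective openTile := fun _ _ h =>
  openTile_subset_iff.1 h.subset

lemma holeArea_openTile (t : Tile) : holeArea (openTile t) = 1 := by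
  simp [holeArea, shape_verts, interior_closedTile, openTile_subset_iff]

lemma numHoles_eq {F S : Finset Tile}
    (hF : ∀ t, t ∉ F → ¬ Bornology.IsBounded (tileComponent S t))
    (hM : ∀ t ∈ F, t ∉ S → ∀ d, nbr d t ∈ S) : numHoles S = (F \ S).card := by
  rw [numHoles, holes_eq hF hM, openTile_injective.injOn.ncard_image, Set.ncard_coe_finset]

/-- If there are as many holes as tiles of `F \ S`, then no two of these tiles are adjacent. -/
lemma nbr_mem_of_numHoles {F S : Finset Tile}
    (hF : ∀ t, t ∉ F → ¬ Bornology.IsBounded (tileComponent S t))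
    (hh : (F \ S).card ≤ numHoles S) {t : Tile} (ht : t ∈ F) (htS : t ∉ S) {d : Fin 3}
    (hn : nbr d t ∈ F) : nbr d t ∈ S := by
  by_contra hnS
  classical
  have hsub := holes_subset hF
  rw [← Finset.coe_image] at hsub
  -- Components of missing tiles account for all holes, and there are at least as many holes as
  -- missing tiles. So distinct missing tiles have distinct components, whereas adjacent ones would
  -- share one.
  have h1 : numHoles S ≤ ((F \ S).image (tileComponent S)).card := by
    rw [← Set.ncard_coe_finset]
    exact Set.ncard_le_ncard hsub (Finset.finite_toSet _)
  have h2 := Finset.card_image_iff.1 (le_antisymm Finset.card_image_le (hh.trans h1))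
  refine nbr_ne d t (h2 ?_ ?_ (tileComponent_nbr htS hnS)) <;> simp [*]

/-- An edge between `S` and a missing tile bounds the hole at that tile. The other perimeter edges
are those of `F`, because a missing tile never shares an edge with the outside of `F`. -/
lemma outerPerimeter_eq {F S : Finset Tile} (hSF : S ⊆ F)
    (hF : ∀ t, t ∉ F → ¬ Bornology.IsBounded (tileComponent S t))
    (hM : ∀ t ∈ F, t ∉ S → ∀ d, nbr d t ∈ S) : outerPerimeter S = (boundaryPairs F).card := by
  have : {e ∈ perimeterEdges S | ¬ ∃ H ∈ holes S, shape e ⊆ frontier H} = perimeterEdges F := by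
    rw [holes_eq hF hM, perimeterEdges_eq, perimeterEdges_eq]
    ext e
    constructor
    · rintro ⟨⟨⟨t, d⟩, hp, rfl⟩, hH⟩
      obtain ⟨ht, hn⟩ := mem_boundaryPairs.1 hp
      refine ⟨(t, d), mem_boundaryPairs.2 ⟨hSF ht, fun hnF => hH ?_⟩, rfl⟩
      refine ⟨_, ⟨nbr d t, by simp [hnF, hn], rfl⟩, fun z hz => ?_⟩
      rw [frontier, closure_openTile, (isOpen_openTile _).interior_eq]
      refine ⟨shape_edge_subset_nbr d t hz, fun h => nbr_ne d t ?_⟩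
      exact eq_of_mem_openTile_of_mem_closedTile h (shape_edge_subset d t hz)
    · rintro ⟨⟨t, d⟩, hp, rfl⟩
      obtain ⟨ht, hn⟩ := mem_boundaryPairs.1 hp
      have htS : t ∈ S := by
        by_contra htS
        exact hn (hSF (hM t ht htS d))
      refine ⟨⟨(t, d), mem_boundaryPairs.2 ⟨htS, fun h => hn (hSF h)⟩, rfl⟩, ?_⟩
      rintro ⟨_, ⟨s, hs, rfl⟩, hsub⟩
      have hs := Finset.mem_sdiff.1 (Finset.mem_coe.1 hs)
      obtain ⟨z, hz, hzr⟩ := exists_mem_shape_edge d t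
      have hzs := frontier_subset_closure (hsub hz)
      rw [closure_openTile] at hzs
      rcases eq_or_eq_of_mem_openRhombus hzr hzs with rfl | rfl
      · exact hs.2 htS
      · exact hn hs.1
  rw [outerPerimeter, this, ← perimeter_eq, perimeter]

/-! ### Hexagons without a corner -/

lemma mem_hexagon_up {k : ℕ} {a b : ℤ} : (a, b, true) ∈ hexagon k ↔
    (-k ≤ a ∧ a < k) ∧ (-k ≤ b ∧ b < k) ∧ (-k ≤ a + b ∧ a + b < k) := by
  rw [hexagon, Finset.mem_filter]
  simp [Tile.verts]
  omega

lemma mem_hexagon_down {k : ℕ} {a b : ℤ} : (a, b, false) ∈ hexagon k ↔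
    (-k ≤ a ∧ a < k) ∧ (-k ≤ b ∧ b < k) ∧ (-k ≤ a + b + 1 ∧ a + b + 1 < k) := by
  rw [hexagon, Finset.mem_filter]
  simp [Tile.verts]
  omega

lemma hexagon_mono {k l : ℕ} (h : k ≤ l) : hexagon k ⊆ hexagon l := by
  rintro ⟨a, b, u⟩ ht
  cases u <;> simp only [mem_hexagon_up, mem_hexagon_down] at * <;> omega

lemma mem_layer {k : ℕ} {t : Tile} : t ∈ layer k ↔ t ∈ hexagon k ∧ t ∉ hexagon (k - 1) := by
  simp [layer]

lemma mem_corner {k : ℕ} (hk : 0 < k) {t : Tile} :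
    t ∈ corner k ↔ t = ((k : ℤ) - 1, -(k : ℤ), true) ∨ t = ((k : ℤ) - 1, -(k : ℤ), false) := by
  obtain ⟨a, b, u⟩ := t
  rw [corner, Finset.mem_filter]
  cases u <;> simp [mem_layer, mem_hexagon_up, mem_hexagon_down, Tile.verts] <;> omega

lemma corner_subset {k : ℕ} : corner k ⊆ hexagon k := fun _ ht =>
  (mem_layer.1 (Finset.mem_filter.1 ht).1).1

/-- The hexagon of side length `k` without the two tiles in its bottom right corner. -/
noncomputable def filled (k : ℕ) : Finset Tile := hexagon k \ corner k

lemma mem_filled {k : ℕ} {t : Tile} : t ∈ filled k ↔ t ∈ hexagon k ∧ t ∉ corner k := by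
  simp [filled]

lemma nbr_mem_filled {k : ℕ} (hk : 0 < k) {t : Tile} (ht : t ∈ hexagon (k - 1)) (d : Fin 3) :
    nbr d t ∈ filled k := by
  obtain ⟨a, b, u⟩ := t
  fin_cases d <;> cases u <;>
    simp [mem_filled, mem_corner hk, mem_hexagon_up, mem_hexagon_down] at * <;> omega

lemma mem_hexagon_of_mem_filled {k : ℕ} {S : Finset Tile} (hS : layer k \ corner k ⊆ S) {t : Tile}
    (ht : t ∈ filled k) (htS : t ∉ S) : t ∈ hexagon (k - 1) := by
  by_contra h
  have h' := mem_filled.1 ht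
  exact htS (hS (Finset.mem_sdiff.2 ⟨mem_layer.2 ⟨h'.1, h⟩, h'.2⟩))

/-! ### Counting -/

lemma card_up_hexagon (k : ℕ) : ((hexagon k).filter Tile.IsUp).card = 3 * k ^ 2 := by
  classical
  let I := Finset.Ico (0 : ℤ) k ×ˢ Finset.Ico (-k : ℤ) 0
  have hI : I.card = k ^ 2 := by simp [I, sq]
  -- Three `k × k` rhombi, obtained from one another by cyclically shifting the coordinates `a`,
  -- `b`, `-1 - a - b`, that is, by rotations through 120°.
  have h : (hexagon k).filter Tile.IsUp =
      (I.image (fun p : ℤ × ℤ => ((p.1, p.2, true) : Tile)) ∪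
        I.image (fun p : ℤ × ℤ => ((-1 - p.1 - p.2, p.1, true) : Tile))) ∪
        I.image (fun p : ℤ × ℤ => ((p.2, -1 - p.1 - p.2, true) : Tile)) := by
    ext ⟨a, b, u⟩
    cases u
    · simp [Tile.IsUp]
    · simp only [Finset.mem_filter, mem_hexagon_up, Tile.IsUp, and_true, Finset.mem_union,
        Finset.mem_image, Prod.exists, Prod.mk.injEq, I, Finset.mem_product, Finset.mem_Ico]
      constructor
      · intro h
        by_cases h1 : 0 ≤ a ∧ b < 0
        · exact Or.inl (Or.inl ⟨a, b, by omega⟩)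
        · by_cases h2 : 0 ≤ b
          · by_cases h3 : -1 - a - b < 0
            · exact Or.inl (Or.inr ⟨b, -1 - a - b, by omega⟩)
            · exact Or.inr ⟨-1 - a - b, a, by omega⟩
          · exact Or.inr ⟨-1 - a - b, a, by omega⟩
      · rintro ((⟨x, y, h⟩ | ⟨x, y, h⟩) | ⟨x, y, h⟩) <;> omega
  rw [h, Finset.card_union_of_disjoint, Finset.card_union_of_disjoint,
    Finset.card_image_of_injective, Finset.card_image_of_injective, Finset.card_image_of_injective,
    hI]
  · ring
  · rintro ⟨x, y⟩ ⟨x', y'⟩ h; simp at h ⊢; omega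
  · rintro ⟨x, y⟩ ⟨x', y'⟩ h; simp at h ⊢; omega
  · rintro ⟨x, y⟩ ⟨x', y'⟩ h; simp at h ⊢; omega
  · simp only [Finset.disjoint_left, Finset.mem_image, Prod.exists, I, Finset.mem_product,
      Finset.mem_Ico, not_exists]
    rintro _ ⟨x, y, h, rfl⟩ x' y' ⟨h', h2⟩
    simp at h2; omega
  · simp only [Finset.disjoint_left, Finset.mem_union, Finset.mem_image, Prod.exists, I,
      Finset.mem_product, Finset.mem_Ico, not_exists]
    rintro _ (⟨x, y, h, rfl⟩ | ⟨x, y, h, rfl⟩) x' y' ⟨h', h2⟩ <;> simp at h2 <;> omega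

/-- The point reflection in the origin exchanges up- and down-triangles. -/
lemma card_down_hexagon (k : ℕ) : ((hexagon k).filter Tile.IsDown).card = 3 * k ^ 2 := by
  rw [← card_up_hexagon]
  refine Finset.card_nbij' (fun t => (-1 - t.1, -1 - t.2.1, true))
    (fun t => (-1 - t.1, -1 - t.2.1, false)) ?_ ?_ ?_ ?_
  all_goals
    rintro ⟨a, b, u⟩
    cases u <;> simp [Tile.IsUp, Tile.IsDown, mem_hexagon_up, mem_hexagon_down]
  all_goals omega

lemma card_hexagon (k : ℕ) : (hexagon k).card = 6 * k ^ 2 := by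
  have h := Finset.card_filter_add_card_filter_not (s := hexagon k) Tile.IsUp
  have h' : (hexagon k).filter (fun t => ¬ Tile.IsUp t) = (hexagon k).filter Tile.IsDown := by
    refine Finset.filter_congr fun t _ => ?_
    simp [Tile.IsUp, Tile.IsDown]
  rw [h', card_up_hexagon, card_down_hexagon] at h
  omega

lemma card_corner {k : ℕ} (hk : 0 < k) : (corner k).card = 2 := by
  have : corner k = {((k : ℤ) - 1, -(k : ℤ), true), ((k : ℤ) - 1, -(k : ℤ), false)} := by
    ext t; rw [mem_corner hk]; simp
  rw [this, Finset.card_pair (by simp)]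

lemma card_filled {k : ℕ} (hk : 0 < k) : (filled k).card = 6 * k ^ 2 - 2 := by
  rw [filled, Finset.card_sdiff_of_subset corner_subset, card_hexagon, card_corner hk]

lemma card_layer_down (k : ℕ) :
    ((layer (k + 1)).filter Tile.IsDown).card = 3 * (k + 1) ^ 2 - 3 * k ^ 2 := by
  have : (layer (k + 1)).filter Tile.IsDown =
      (hexagon (k + 1)).filter Tile.IsDown \ (hexagon k).filter Tile.IsDown := by
    ext t; simp [mem_layer]; tauto
  rw [this, Finset.card_sdiff_of_subset
    (Finset.filter_subset_filter _ (hexagon_mono (Nat.le_succ k))),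
    card_down_hexagon, card_down_hexagon]

lemma corner_subset_layer {k : ℕ} : corner k ⊆ layer k := Finset.filter_subset _ _

lemma card_layer_sdiff_corner (k : ℕ) :
    (layer (k + 1) \ corner (k + 1)).card = 6 * (k + 1) ^ 2 - 6 * k ^ 2 - 2 := by
  rw [Finset.card_sdiff_of_subset corner_subset_layer, layer, Nat.add_sub_cancel,
    Finset.card_sdiff_of_subset (hexagon_mono (Nat.le_succ k)), card_hexagon, card_hexagon,
    card_corner k.succ_pos]

lemma two_mul_nSeq (k : ℕ) : 2 * ((9 * k ^ 2 + 3 * k) / 2) = 9 * k ^ 2 + 3 * k := by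
  refine Nat.two_mul_div_two_of_even ?_
  rcases Nat.even_or_odd k with h | h
  · exact ((h.pow_of_ne_zero two_ne_zero).mul_left 9).add (h.mul_left 3)
  · exact ((by decide : Odd 9).mul h.pow).add_odd ((by decide : Odd 3).mul h)

lemma two_mul_hSeq (k : ℕ) : 2 * (hSeq k : ℤ) = 3 * k * (k - 1) := by
  rcases k with _ | k
  · simp [hSeq]
  · have h1 : Even (k * (k + 1)) := Nat.even_mul_succ_self k
    rw [hSeq, Nat.choose_two_right, Nat.add_sub_cancel]
    have h3 : 2 * ((k + 1) * k / 2) = (k + 1) * k :=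
      Nat.two_mul_div_two_of_even (mul_comm k _ ▸ h1)
    push_cast
    zify at h3
    linear_combination 3 * h3

lemma two_mul_nSeq_int {k : ℕ} (hk : 0 < k) : 2 * (nSeq k : ℤ) = 9 * k ^ 2 + 3 * k - 4 := by
  have h := two_mul_nSeq k
  have h1 : 1 ≤ k ^ 2 := Nat.one_le_pow _ _ hk
  have : nSeq k + 2 = (9 * k ^ 2 + 3 * k) / 2 := by rw [nSeq]; omega
  zify at this h
  linarith

lemma nSeq_add_hSeq {k : ℕ} (hk : 0 < k) : nSeq k + hSeq k = 6 * k ^ 2 - 2 := by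
  have h1 := two_mul_nSeq_int hk
  have h2 := two_mul_hSeq k
  have h3 : 1 ≤ k ^ 2 := Nat.one_le_pow _ _ hk
  have : 2 * (nSeq k + hSeq k : ℤ) = 2 * (6 * (k : ℤ) ^ 2 - 2) := by linear_combination h1 + h2
  zify [show 2 ≤ 6 * k ^ 2 by omega]
  linarith

/-- The hexagon of side length `k` without its corner has perimeter `6 * k`. -/
lemma card_boundaryPairs_filled {k : ℕ} (hk : 0 < k) :
    (boundaryPairs (filled k)).card = 6 * k := by
  -- In each direction one coordinate indexes the boundary edges. Cutting off the corner only moves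
  -- one edge of direction 0 and one of direction 1 to a parallel position; these give the special
  -- cases `b = -k` and `a = k - 1`.
  have key : ∀ d : Fin 3, ((boundaryPairs (filled k)).filter fun p => p.2 = d).card = 2 * k := by
    intro d
    have hc : (Finset.Ico (-k : ℤ) k).card = 2 * k := by simp; omega
    have hf : ((boundaryPairs (filled k)).filter fun p => p.2 = d) =
        ((filled k).filter fun t => nbr d t ∉ filled k).image fun t => (t, d) := by
      ext ⟨t, d'⟩
      simp only [Finset.mem_filter, mem_boundaryPairs, Finset.mem_image, Prod.mk.injEq]
      constructor
      · rintro ⟨h, rfl⟩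
        exact ⟨t, h, rfl, rfl⟩
      · rintro ⟨_, h, rfl, rfl⟩
        exact ⟨h, rfl⟩
    rw [hf, Finset.card_image_of_injective _ (Prod.mk_left_injective d), ← hc]
    fin_cases d
    · refine Finset.card_bij (fun t _ => t.2.1) ?_ ?_ ?_
      · rintro ⟨a, b, u⟩
        cases u <;> simp [mem_filled, mem_corner hk, mem_hexagon_up, mem_hexagon_down] <;> omega
      · rintro ⟨a, b, u⟩ h ⟨a', b', u'⟩ h' hb
        cases u <;> cases u' <;> simp [mem_filled, mem_corner hk, mem_hexagon_up,
          mem_hexagon_down] at * <;> omega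
      · intro b hb
        simp only [Finset.mem_Ico] at hb
        by_cases h1 : 0 ≤ b
        · exact ⟨(-k, b, true), by
            simp [mem_filled, mem_corner hk, mem_hexagon_up, mem_hexagon_down]; omega, rfl⟩
        · by_cases h2 : b = -k
          · exact ⟨(k - 2, b, false), by
              simp [mem_filled, mem_corner hk, mem_hexagon_up, mem_hexagon_down]; omega, rfl⟩
          · exact ⟨(k - 1, b, false), by
              simp [mem_filled, mem_corner hk, mem_hexagon_up, mem_hexagon_down]; omega, rfl⟩
    · refine Finset.card_bij (fun t _ => t.1) ?_ ?_ ?_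
      · rintro ⟨a, b, u⟩
        cases u <;> simp [mem_filled, mem_corner hk, mem_hexagon_up, mem_hexagon_down] <;> omega
      · rintro ⟨a, b, u⟩ h ⟨a', b', u'⟩ h' hb
        cases u <;> cases u' <;> simp [mem_filled, mem_corner hk, mem_hexagon_up,
          mem_hexagon_down] at * <;> omega
      · intro a ha
        simp only [Finset.mem_Ico] at ha
        by_cases h1 : a < 0
        · exact ⟨(a, k - 1, false), by
            simp [mem_filled, mem_corner hk, mem_hexagon_up, mem_hexagon_down]; omega, rfl⟩
        · by_cases h2 : a = k - 1
          · exact ⟨(a, -k + 1, true), by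
              simp [mem_filled, mem_corner hk, mem_hexagon_up, mem_hexagon_down]; omega, rfl⟩
          · exact ⟨(a, -k, true), by
              simp [mem_filled, mem_corner hk, mem_hexagon_up, mem_hexagon_down]; omega, rfl⟩
    · refine Finset.card_bij (fun t _ => t.1) ?_ ?_ ?_
      · rintro ⟨a, b, u⟩
        cases u <;> simp [mem_filled, mem_corner hk, mem_hexagon_up, mem_hexagon_down] <;> omega
      · rintro ⟨a, b, u⟩ h ⟨a', b', u'⟩ h' hb
        cases u <;> cases u' <;> simp [mem_filled, mem_corner hk, mem_hexagon_up,
          mem_hexagon_down] at * <;> omega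
      · intro a ha
        simp only [Finset.mem_Ico] at ha
        by_cases h1 : 0 ≤ a
        · exact ⟨(a, k - 1 - a, true), by
            simp [mem_filled, mem_corner hk, mem_hexagon_up, mem_hexagon_down]; omega, rfl⟩
        · exact ⟨(a, -k - 1 - a, false), by
            simp [mem_filled, mem_corner hk, mem_hexagon_up, mem_hexagon_down]; omega, rfl⟩
  rw [Finset.card_eq_sum_card_fiberwise (f := Prod.snd) (t := Finset.univ) (fun _ _ => by simp)]
  simp [key]
  ring

/-! ### The outside of a hexagon without a corner -/

/-- The region covered by `filled k`, in terms of coordinates. -/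
def filledRegion (k : ℕ) : Set ℂ :=
  {z | (∀ d, -(k : ℝ) ≤ co d z ∧ co d z ≤ k) ∧ (co 0 z ≤ k - 1 ∨ -(k - 1 : ℝ) ≤ co 1 z)}

lemma region_filled_subset {k : ℕ} (hk : 0 < k) : region (filled k) ⊆ filledRegion k := by
  intro z hz
  obtain ⟨t, ht, hzt⟩ := mem_region.1 hz
  have hb : ∀ d, -(k : ℤ) ≤ tc d t ∧ tc d t + 1 ≤ k := by
    have := (mem_filled.1 ht).1
    obtain ⟨a, b, u⟩ := t
    intro d
    fin_cases d <;> cases u <;> simp [mem_hexagon_up, mem_hexagon_down] at * <;> omega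
  refine ⟨fun d => ?_, ?_⟩
  · have h1 : (-(k : ℤ) : ℝ) ≤ tc d t := by exact_mod_cast (hb d).1
    have h2 : (tc d t : ℝ) + 1 ≤ k := by exact_mod_cast (hb d).2
    push_cast at h1
    exact ⟨h1.trans (hzt d).1, (hzt d).2.trans h2⟩
  · have : tc 0 t + 1 ≤ k - 1 ∨ -(k - 1 : ℤ) ≤ tc 1 t := by
      have h := mem_filled.1 ht
      obtain ⟨a, b, u⟩ := t
      cases u <;> simp [mem_hexagon_up, mem_hexagon_down, mem_corner hk] at * <;> omega
    refine this.imp (fun h => (hzt 0).2.trans ?_) (fun h => le_trans ?_ (hzt 1).1)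
    · exact_mod_cast h
    · exact_mod_cast h

lemma center_notMem_filledRegion {k : ℕ} (hk : 0 < k) {t : Tile} (ht : t ∉ filled k) :
    center t ∉ filledRegion k := by
  rintro ⟨h, h'⟩
  apply ht
  have hc := center_mem t
  have key : ∀ d, -(k : ℤ) ≤ tc d t ∧ tc d t < k := by
    intro d
    have h1 : (-(k : ℤ) : ℝ) < tc d t + 1 := by push_cast; linarith [(h d).1, (hc d).2]
    have h2 : (tc d t : ℝ) < k := by linarith [(h d).2, (hc d).1]
    norm_cast at h1 h2
    omega
  have key' : tc 0 t < k - 1 ∨ -(k - 1 : ℤ) < tc 1 t + 1 := by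
    refine h'.imp (fun h => ?_) (fun h => ?_)
    · have : (tc 0 t : ℝ) < k - 1 := by linarith [(hc 0).1]
      exact_mod_cast this
    · have : (-(k - 1) : ℝ) < tc 1 t + 1 := by linarith [(hc 1).2]
      exact_mod_cast this
  have k0 := key 0
  have k1 := key 1
  have k2 := key 2
  obtain ⟨a, b, u⟩ := t
  cases u <;> simp [mem_filled, mem_hexagon_up, mem_hexagon_down, mem_corner hk] at * <;> omega

/-- The set is not convex, but all its defining half-planes contain the origin as `k ≥ 1`; hence it
is star-shaped. -/
lemma smul_notMem_filledRegion {k : ℕ} (hk : 0 < k) {z : ℂ} (hz : z ∉ filledRegion k) {s : ℝ}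
    (hs : 1 ≤ s) : s • z ∉ filledRegion k := by
  have hk' : (1 : ℝ) ≤ k := by exact_mod_cast hk
  contrapose! hz
  obtain ⟨h, h'⟩ := hz
  simp only [map_smul, smul_eq_mul] at h h'
  refine ⟨fun d => ⟨?_, ?_⟩, h'.imp (fun h => ?_) (fun h => ?_)⟩
  · by_contra! hc; nlinarith [(h d).1]
  · by_contra! hc; nlinarith [(h d).2]
  · by_contra! hc; nlinarith
  · by_contra! hc; nlinarith

lemma not_isBounded_tileComponent {k : ℕ} (hk : 0 < k) {S : Finset Tile} (hS : S ⊆ filled k)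
    {t : Tile} (ht : t ∉ filled k) : ¬ Bornology.IsBounded (tileComponent S t) := by
  intro hb
  set c := center t
  have hc : c ∉ filledRegion k := center_notMem_filledRegion hk ht
  have hc0 : c ≠ 0 := by
    rintro h0
    apply hc
    rw [h0]
    have : (1 : ℝ) ≤ k := by exact_mod_cast hk
    refine ⟨fun d => by simp, Or.inl (by simpa using this)⟩
  have hray : (fun s : ℝ => s • c) '' Set.Ici 1 ⊆ tileComponent S t := by
    refine (isPreconnected_Ici.image _ (by fun_prop)).subset_connectedComponentIn
      ⟨1, Set.self_mem_Ici, one_smul _ _⟩ ?_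
    rintro _ ⟨s, hs, rfl⟩ h
    exact smul_notMem_filledRegion hk hc hs (region_filled_subset hk (region_mono hS h))
  obtain ⟨C, hC⟩ := (hb.subset hray).exists_norm_le
  have hpos : 0 < ‖c‖ := norm_pos_iff.2 hc0
  have h1 := hC _ ⟨max 1 ((C + 1) / ‖c‖), Set.mem_Ici.2 (le_max_left _ _), rfl⟩
  simp only [norm_smul] at h1
  have h2 : (C + 1) / ‖c‖ ≤ ‖max 1 ((C + 1) / ‖c‖)‖ := (le_max_right _ _).trans (le_abs_self _)
  have h3 := mul_le_mul_of_nonneg_right h2 hpos.le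
  rw [div_mul_cancel₀ _ hpos.ne'] at h3
  linarith

/-! ### Connectivity -/

/-- Two tiles of `A` are linked in `A` if a chain of adjacent tiles of `A` joins them. -/
def Linked (A : Finset Tile) : Tile → Tile → Prop :=
  Relation.ReflTransGen fun s t => s ∈ A ∧ t ∈ A ∧ ∃ d, t = nbr d s

namespace Linked

lemma refl (A : Finset Tile) (t : Tile) : Linked A t t := Relation.ReflTransGen.refl

lemma trans {A : Finset Tile} {r s t : Tile} (h : Linked A r s) (h' : Linked A s t) :
    Linked A r t := Relation.ReflTransGen.trans h h'

lemma symm {A : Finset Tile} {s t : Tile} (h : Linked A s t) : Linked A t s := by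
  induction h with
  | refl => exact refl A s
  | tail _ h ih =>
    obtain ⟨hs, ht, d, rfl⟩ := h
    exact ih.head ⟨ht, hs, d, (nbr_nbr d _).symm⟩

lemma mono {A B : Finset Tile} (hAB : A ⊆ B) {s t : Tile} (h : Linked A s t) : Linked B s t :=
  Relation.ReflTransGen.mono (fun _ _ h => ⟨hAB h.1, hAB h.2.1, h.2.2⟩) _ _ h

lemma of_nbr {A : Finset Tile} {s t : Tile} (hs : s ∈ A) (ht : t ∈ A) (d : Fin 3)
    (h : nbr d s = t) : Linked A s t :=
  Relation.ReflTransGen.single ⟨hs, ht, d, h.symm⟩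

end Linked

lemma IsPolyiamond.linked {A : Finset Tile} (hA : IsPolyiamond A) {s t : Tile} (hs : s ∈ A)
    (ht : t ∈ A) : Linked A s t := by
  have h := (SimpleGraph.reachable_iff_reflTransGen _ _).1 (hA.preconnected ⟨s, hs⟩ ⟨t, ht⟩)
  exact Relation.ReflTransGen.lift (r := (dualGraph A).Adj) Subtype.val
    (fun x y hxy => ⟨x.2, y.2, dualGraph_adj.1 hxy⟩) _ _ h

lemma isPolyiamond_of_linked {A : Finset Tile} {r : Tile} (hr : r ∈ A)
    (h : ∀ t ∈ A, Linked A r t) : IsPolyiamond A := by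
  have key : ∀ t, Linked A r t → ∃ ht : t ∈ A, (dualGraph A).Reachable ⟨r, hr⟩ ⟨t, ht⟩ := by
    intro t ht
    induction ht with
    | refl => exact ⟨hr, .refl _⟩
    | tail _ hst ih =>
      obtain ⟨hs, ht, d, hd⟩ := hst
      obtain ⟨_, hreach⟩ := ih
      exact ⟨ht, hreach.trans (SimpleGraph.Adj.reachable (dualGraph_adj.2 ⟨d, hd⟩))⟩
  have hreach : ∀ t : {t // t ∈ A}, (dualGraph A).Reachable ⟨r, hr⟩ t := fun t =>
    (key t.1 (h t.1 t.2)).2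
  have : Nonempty {t // t ∈ A} := ⟨⟨r, hr⟩⟩
  exact ⟨fun s t => (hreach s).symm.trans (hreach t)⟩

lemma IsPolyiamond.nonempty {A : Finset Tile} (hA : IsPolyiamond A) : A.Nonempty := by
  obtain ⟨t, ht⟩ := SimpleGraph.Connected.nonempty hA
  exact ⟨t, ht⟩

lemma tc_nbr_bounds (d e : Fin 3) (t : Tile) :
    tc e (nbr d t) ≤ tc e t + 1 ∧ tc e t ≤ tc e (nbr d t) + 1 := by
  obtain ⟨a, b, u⟩ := t
  fin_cases d <;> fin_cases e <;> cases u <;> simp <;> omega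

/-- The coordinates of the tiles of a polyiamond form intervals. -/
lemma IsPolyiamond.exists_tc_eq {A : Finset Tile} (hA : IsPolyiamond A) {s t : Tile} (hs : s ∈ A)
    (ht : t ∈ A) {d : Fin 3} {c : ℤ} (h1 : tc d s ≤ c) (h2 : c ≤ tc d t) :
    ∃ u ∈ A, tc d u = c := by
  have h := hA.linked hs ht
  clear ht
  -- Discrete intermediate value argument: each coordinate changes by at most one between
  -- neighbours.
  induction h with
  | refl => exact ⟨s, hs, le_antisymm h1 h2⟩
  | @tail x y _ hst ih =>
    obtain ⟨hx, hy, e, rfl⟩ := hst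
    rcases eq_or_lt_of_le h2 with h | h
    · exact ⟨_, hy, h.symm⟩
    · exact ih (by linarith [(tc_nbr_bounds e d x).1])

/-! ### Counting edges of the dual graph -/

open Classical in
lemma degree_add_card {A : Finset Tile} (t : {t // t ∈ A}) :
    (dualGraph A).degree t + (Finset.univ.filter fun d => nbr d t.1 ∉ A).card = 3 := by
  have h : (dualGraph A).degree t = (Finset.univ.filter fun d => nbr d t.1 ∈ A).card := by
    rw [← SimpleGraph.card_neighborFinset_eq_degree]
    symm
    refine Finset.card_bij (fun d hd => ⟨nbr d t.1, (Finset.mem_filter.1 hd).2⟩) ?_ ?_ ?_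
    · intro d hd
      rw [SimpleGraph.mem_neighborFinset]
      exact dualGraph_adj.2 ⟨d, rfl⟩
    · intro d _ d' _ h
      exact nbr_inj (Subtype.ext_iff.1 h)
    · intro s hs
      rw [SimpleGraph.mem_neighborFinset] at hs
      obtain ⟨d, hd⟩ := dualGraph_adj.1 hs
      exact ⟨d, by simp [← hd], Subtype.ext hd.symm⟩
  rw [h, Finset.card_filter_add_card_filter_not]
  simp

open Classical in
lemma card_boundaryPairs_eq_sum (A : Finset Tile) :
    (boundaryPairs A).card = ∑ t ∈ A, (Finset.univ.filter fun d => nbr d t ∉ A).card := by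
  simp only [boundaryPairs, Finset.card_filter, Finset.sum_product]

-- Each of the three directions at a tile leads to a neighbour in `A`, counted by the degree, or
-- across a boundary edge.
open Classical in
lemma two_mul_card_edges_add (A : Finset Tile) :
    2 * (dualGraph A).edgeFinset.card + (boundaryPairs A).card = 3 * A.card := by
  rw [← SimpleGraph.sum_degrees_eq_twice_card_edges, card_boundaryPairs_eq_sum,
    ← Finset.sum_coe_sort A, ← Finset.sum_add_distrib, Finset.sum_congr rfl
      fun t _ => degree_add_card t]
  simp [mul_comm]

lemma IsPolyiamond.isTree {A : Finset Tile} (hA : IsPolyiamond A)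
    (h : (boundaryPairs A).card = A.card + 2) : (dualGraph A).IsTree := by
  classical
  rw [SimpleGraph.isTree_iff_connected_and_card]
  refine ⟨hA, ?_⟩
  have h1 := two_mul_card_edges_add A
  have h2 : Nat.card (dualGraph A).edgeSet = (dualGraph A).edgeFinset.card := by
    rw [Nat.card_eq_fintype_card, SimpleGraph.edgeFinset_card]
  rw [h2, Nat.card_eq_fintype_card, Fintype.card_coe]
  omega

/-- Removing from `F` isolated tiles none of which is at the boundary adds three boundary edges
for each of them. -/
lemma card_boundaryPairs_sdiff {F S : Finset Tile} (hSF : S ⊆ F)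
    (hM : ∀ t ∈ F, t ∉ S → ∀ d, nbr d t ∈ S) :
    (boundaryPairs S).card = 3 * (F \ S).card + (boundaryPairs F).card := by
  classical
  -- A missing tile contributes the three pairs that look at it from its neighbours.
  have h : boundaryPairs S =
      ((F \ S) ×ˢ (Finset.univ : Finset (Fin 3))).image (fun p => (nbr p.2 p.1, p.2)) ∪
        boundaryPairs F := by
    ext ⟨t, d⟩
    simp only [mem_boundaryPairs, Finset.mem_union, Finset.mem_image, Finset.mem_product,
      Finset.mem_sdiff, Finset.mem_univ, and_true, Prod.mk.injEq]
    constructor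
    · rintro ⟨ht, hn⟩
      by_cases hF : nbr d t ∈ F
      · exact Or.inl ⟨(nbr d t, d), ⟨hF, hn⟩, nbr_nbr d t, rfl⟩
      · exact Or.inr ⟨hSF ht, hF⟩
    · rintro (⟨⟨s, e⟩, ⟨hs, hsS⟩, rfl, rfl⟩ | ⟨ht, hn⟩)
      · exact ⟨hM s hs hsS _, by rwa [nbr_nbr]⟩
      · refine ⟨?_, fun h => hn (hSF h)⟩
        by_contra htS
        exact hn (hSF (hM t ht htS d))
  rw [h, Finset.card_union_of_disjoint, Finset.card_image_of_injective]
  · simp [mul_comm]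
  · rintro ⟨s, d⟩ ⟨t, e⟩ h
    simp only [Prod.mk.injEq] at h ⊢
    obtain ⟨h, rfl⟩ := h
    exact ⟨nbr_left_injective d h, rfl⟩
  · simp only [Finset.disjoint_left, Finset.mem_image, Finset.mem_product, Finset.mem_sdiff,
      mem_boundaryPairs]
    rintro _ ⟨⟨s, d⟩, ⟨⟨hs, hsS⟩, _⟩, rfl⟩ ⟨_, h⟩
    exact h (by rwa [nbr_nbr])

/-! ### The isoperimetric inequality -/

/-- The position of a tile in the row of tiles with the same coordinate `d`. -/
def pos (d : Fin 3) (t : Tile) : ℤ := tc (d + 1) t - tc (d + 2) t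

lemma pos_zero (t : Tile) : pos 0 t = tc 1 t - tc 2 t := rfl
lemma pos_one (t : Tile) : pos 1 t = tc 2 t - tc 0 t := rfl
lemma pos_two (t : Tile) : pos 2 t = tc 0 t - tc 1 t := rfl

lemma exists_nbr_pos (d : Fin 3) (t : Tile) : ∃ e e', e ≠ d ∧ e' ≠ d ∧ e ≠ e' ∧
    pos d (nbr e t) = pos d t + 1 ∧ pos d (nbr e' t) = pos d t - 1 := by
  obtain ⟨a, b, u⟩ := t
  fin_cases d <;> cases u
  · exact ⟨1, 2, by decide, by decide, by decide, by simp [pos_zero]; ring, by simp [pos_zero]; ring⟩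
  · exact ⟨2, 1, by decide, by decide, by decide, by simp [pos_zero]; ring, by simp [pos_zero]; ring⟩
  · exact ⟨2, 0, by decide, by decide, by decide, by simp [pos_one]; ring, by simp [pos_one]; ring⟩
  · exact ⟨0, 2, by decide, by decide, by decide, by simp [pos_one]; ring, by simp [pos_one]; ring⟩
  · exact ⟨0, 1, by decide, by decide, by decide, by simp [pos_two]; ring, by simp [pos_two]; ring⟩
  · exact ⟨1, 0, by decide, by decide, by decide, by simp [pos_two]; ring, by simp [pos_two]; ring⟩

/-- Every row of `A` has at least two boundary edges at its ends. -/
lemma two_le_card_row {A : Finset Tile} {d : Fin 3} {t₀ : Tile} (ht₀ : t₀ ∈ A) :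
    2 ≤ (((boundaryPairs A).filter fun p => p.2 ≠ d).filter
      fun p => tc d p.1 = tc d t₀).card := by
  have hne : (A.filter fun t => tc d t = tc d t₀).Nonempty := ⟨t₀, by simp [ht₀]⟩
  obtain ⟨s, hs, hmax⟩ := Finset.exists_max_image _ (pos d) hne
  obtain ⟨t, ht, hmin⟩ := Finset.exists_min_image _ (pos d) hne
  simp only [Finset.mem_filter] at hs ht hmax hmin
  obtain ⟨e, -, he, -, -, hse, -⟩ := exists_nbr_pos d s
  obtain ⟨-, f, -, hf, -, -, htf⟩ := exists_nbr_pos d t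
  -- The forward edge of the last tile and the backward edge of the first one; they differ even if
  -- the row is a single tile.
  refine Finset.one_lt_card.2 ⟨(s, e), ?_, (t, f), ?_, ?_⟩
  · simp only [Finset.mem_filter, mem_boundaryPairs]
    refine ⟨⟨⟨hs.1, fun h => ?_⟩, he⟩, hs.2⟩
    have := hmax _ ⟨h, (tc_nbr_of_ne he.symm s).trans hs.2⟩
    omega
  · simp only [Finset.mem_filter, mem_boundaryPairs]
    refine ⟨⟨⟨ht.1, fun h => ?_⟩, hf⟩, ht.2⟩
    have := hmin _ ⟨h, (tc_nbr_of_ne hf.symm t).trans ht.2⟩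
    omega
  · rintro h
    obtain ⟨rfl, rfl⟩ := Prod.mk.inj h
    omega

lemma two_mul_le_card_boundaryPairs {A : Finset Tile} (hA : IsPolyiamond A) {d : Fin 3}
    {s t : Tile} (hs : s ∈ A) (ht : t ∈ A) :
    2 * (tc d t - tc d s + 1) ≤ ((boundaryPairs A).filter fun p => p.2 ≠ d).card := by
  rcases lt_or_ge (tc d t + 1) (tc d s) with hlt | hle
  · have : (0 : ℤ) ≤ ((boundaryPairs A).filter fun p => p.2 ≠ d).card := Nat.cast_nonneg _
    linarith
  have h1 : ∑ i ∈ Finset.Icc (tc d s) (tc d t), 2 ≤ ∑ i ∈ Finset.Icc (tc d s) (tc d t),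
      (((boundaryPairs A).filter fun p => p.2 ≠ d).filter fun p => tc d p.1 = i).card := by
    refine Finset.sum_le_sum fun i hi => ?_
    obtain ⟨u, hu, rfl⟩ := hA.exists_tc_eq hs ht (Finset.mem_Icc.1 hi).1 (Finset.mem_Icc.1 hi).2
    exact two_le_card_row hu
  rw [Finset.sum_card_fiberwise_eq_card_filter, Finset.sum_const, Int.card_Icc] at h1
  have h2 := h1.trans (Finset.card_filter_le _ _)
  zify at h2
  rw [smul_eq_mul, Nat.cast_mul, Int.toNat_of_nonneg (by linarith)] at h2
  push_cast at h2
  linarith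

/-- A boundary pair is counted for each of the two directions other than its own. -/
lemma sum_card_filter_ne (A : Finset Tile) :
    ∑ d : Fin 3, ((boundaryPairs A).filter fun p => p.2 ≠ d).card =
      2 * (boundaryPairs A).card := by
  have h1 : ∀ d : Fin 3, ((boundaryPairs A).filter fun p => p.2 = d).card +
      ((boundaryPairs A).filter fun p => p.2 ≠ d).card = (boundaryPairs A).card := fun d =>
    Finset.card_filter_add_card_filter_not _
  have h2 := Finset.card_eq_sum_card_fiberwise (f := Prod.snd) (s := boundaryPairs A)
    (t := Finset.univ) (fun _ _ => by simp)
  have h3 := Finset.sum_congr (rfl : (Finset.univ : Finset (Fin 3)) = _) fun d _ => h1 d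
  rw [Finset.sum_add_distrib, ← h2] at h3
  simp only [Finset.sum_const, Finset.card_univ, Fintype.card_fin, smul_eq_mul] at h3
  omega

lemma eq_of_tc_eq_of_pos_eq {s t : Tile} (h : tc 0 s = tc 0 t) (h' : pos 0 s = pos 0 t) :
    s = t := by
  obtain ⟨a, b, u⟩ := t
  obtain ⟨a', b', u'⟩ := s
  rw [pos_zero, pos_zero] at h'
  cases u <;> cases u' <;> simp at * <;> omega

/-- Among `r + 2` terms, the first and the last together are at least `2 * (r + 1)` by the triangle
inequality; removing them leaves the sum of `r` terms for `β - 2`. -/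
lemma sq_le_two_mul_sum_abs (r : ℕ) : ∀ β : ℤ,
    (r : ℤ) ^ 2 ≤ 2 * ∑ x ∈ Finset.range r, |β - 2 * x| + 1 := by
  induction r using Nat.twoStepInduction with
  | zero => simp
  | one => intro β; have := abs_nonneg β; simp
  | more r ih _ =>
    intro β
    have h := ih (β - 2)
    rw [Finset.sum_range_succ, Finset.sum_range_succ']
    have h1 : ∀ x : ℕ, β - 2 * ((x + 1 : ℕ) : ℤ) = β - 2 - 2 * x := fun x => by push_cast; ring
    simp only [h1]
    have h2 := neg_abs_le (β - 2 - 2 * r)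
    have h3 := le_abs_self (β - 2 * ((0 : ℕ) : ℤ))
    push_cast at h3 ⊢
    linarith

/-- The three coordinates sum to `-1` for up- and `-2` for down-triangles, so two of them fix the
position up to the orientation. -/
lemma pos_zero_bounds (t : Tile) : (2 * tc 1 t + tc 0 t + 1 ≤ pos 0 t ∧
    pos 0 t ≤ 2 * tc 1 t + tc 0 t + 2) ∧ (-(2 * tc 2 t + tc 0 t + 2) ≤ pos 0 t ∧
    pos 0 t ≤ -(2 * tc 2 t + tc 0 t + 1)) := by
  obtain ⟨a, b, u⟩ := t
  rw [pos_zero]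
  cases u <;> simp <;> omega

/-- A set of tiles with coordinates in intervals of lengths `r 0`, `r 1`, `r 2`, the first of which
is filled by the coordinates, has at most
`(s ^ 2 + 3) / 6` tiles, where `s` is the sum of the `r i`. -/
lemma six_mul_card_le {A : Finset Tile} (m : Fin 3 → ℤ) (r : Fin 3 → ℕ)
    (hA : ∀ t ∈ A, ∀ d, m d ≤ tc d t ∧ tc d t < m d + r d)
    (hne : ∀ x < r 0, ∃ t ∈ A, tc 0 t = m 0 + x) :
    6 * (A.card : ℤ) ≤ (r 0 + r 1 + r 2 : ℤ) ^ 2 + 3 := by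
  set q : ℤ := r 1 + r 2 with hq
  set β : ℤ := - 2 * m 1 - 2 * m 2 - r 1 - r 2 - 1 - 2 * m 0 with hβ
  have hmaps : Set.MapsTo (fun t => (tc 0 t - m 0).toNat) (A : Set Tile)
      (Finset.range (r 0) : Set ℕ) := by
    intro t ht
    have := hA t ht 0
    simp only [Finset.coe_range, Set.mem_Iio]
    omega
  -- Lower bounds on coordinates 1 and 2 confine the row to one interval of positions, upper bounds
  -- to another. The two lengths add up to `2 * q` and half their difference is `β - 2 * x`, so the
  -- smaller one is the bound.
  have hrow : ∀ x ∈ Finset.range (r 0),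
      ((A.filter fun t => (tc 0 t - m 0).toNat = x).card : ℤ) ≤ q - |β - 2 * x| := by
    intro x hxr
    -- For an empty row the claimed bound could be negative.
    have hpos : 0 < (A.filter fun t => (tc 0 t - m 0).toNat = x).card := by
      obtain ⟨t, ht, hxt⟩ := hne x (Finset.mem_range.1 hxr)
      exact Finset.card_pos.2 ⟨t, Finset.mem_filter.2 ⟨ht, by omega⟩⟩
    have hx : ∀ t ∈ A.filter (fun t => (tc 0 t - m 0).toNat = x), t ∈ A ∧ tc 0 t = m 0 + x := by
      intro t ht
      obtain ⟨ht, hx⟩ := Finset.mem_filter.1 ht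
      have := (hA t ht 0).1
      exact ⟨ht, by omega⟩
    have hcard : ∀ lo hi : ℤ, (∀ t ∈ A, tc 0 t = m 0 + x → lo ≤ pos 0 t ∧ pos 0 t ≤ hi) →
        ((A.filter fun t => (tc 0 t - m 0).toNat = x).card : ℤ) ≤ max 0 (hi + 1 - lo) := by
      intro lo hi h
      have := Finset.card_le_card_of_injOn (t := Finset.Icc lo hi) (pos 0)
        (fun t ht => by
          obtain ⟨h1, h2⟩ := hx t ht
          exact Finset.mem_coe.2 (Finset.mem_Icc.2 (h t h1 h2)))
        (fun s hs t ht hst => eq_of_tc_eq_of_pos_eq ((hx s hs).2.trans (hx t ht).2.symm) hst)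
      rw [Int.card_Icc] at this
      omega
    have h1 := hcard (2 * m 1 + (m 0 + x) + 1) (-(2 * m 2 + (m 0 + x) + 1)) fun t ht hxt => by
      have := pos_zero_bounds t
      have := hA t ht 1
      have := hA t ht 2
      omega
    have h2 := hcard (-(2 * (m 2 + r 2 - 1) + (m 0 + x) + 2))
      (2 * (m 1 + r 1 - 1) + (m 0 + x) + 2) fun t ht hxt => by
      have := pos_zero_bounds t
      have := hA t ht 1
      have := hA t ht 2
      omega
    rcases abs_cases (β - 2 * x) with ⟨h, _⟩ | ⟨h, _⟩ <;> rw [h] <;> omega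
  have hsum := Finset.sum_le_sum hrow
  rw [← Nat.cast_sum, ← Finset.card_eq_sum_card_fiberwise hmaps, Finset.sum_sub_distrib,
    Finset.sum_const, Finset.card_range, nsmul_eq_mul] at hsum
  have h := sq_le_two_mul_sum_abs (r 0) β
  have hq' : (r 0 + r 1 + r 2 : ℤ) = r 0 + q := by rw [hq]; ring
  rw [hq']
  -- By now `2 * A.card ≤ 2 * r 0 * q - r 0 ^ 2 + 1`, and `6 * r 0 * q - 3 * r 0 ^ 2 = (r 0 + q) ^ 2
  -- - (2 * r 0 - q) ^ 2`.
  nlinarith [sq_nonneg (2 * (r 0 : ℤ) - q)]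

/-- The isoperimetric inequality for polyiamonds. -/
lemma IsPolyiamond.six_mul_card_le {A : Finset Tile} (hA : IsPolyiamond A) :
    6 * A.card ≤ perimeter A ^ 2 + 3 := by
  choose s hs hmin using fun d => Finset.exists_min_image A (tc d) hA.nonempty
  choose t ht hmax using fun d => Finset.exists_max_image A (tc d) hA.nonempty
  have hle : ∀ d, tc d (s d) ≤ tc d (t d) := fun d => hmin d _ (ht d)
  have hr : ∀ d, (((tc d (t d) - tc d (s d) + 1).toNat : ℕ) : ℤ) =
      tc d (t d) - tc d (s d) + 1 := fun d => Int.toNat_of_nonneg (by linarith [hle d])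
  have h1 := Polyiamond.six_mul_card_le (A := A) (fun d => tc d (s d))
    (fun d => (tc d (t d) - tc d (s d) + 1).toNat) (fun u hu d => by
      have := hmin d u hu
      have := hmax d u hu
      have := hr d
      omega) (fun x hx => by
      have := hr 0
      exact hA.exists_tc_eq (hs 0) (ht 0) (by omega) (by omega))
  have h2 := fun d => two_mul_le_card_boundaryPairs hA (d := d) (hs d) (ht d)
  have h3 := sum_card_filter_ne A
  have h20 := h2 0
  have h21 := h2 1
  have h22 := h2 2
  rw [Fin.sum_univ_three] at h3
  simp only [hr] at h1
  rw [perimeter_eq]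
  zify at h3 ⊢
  -- Adding the row bounds for the three directions gives `2 * (r_0 + r_1 + r_2) ≤ 2 * p`.
  refine h1.trans (add_le_add_left (pow_le_pow_left₀ ?_ ?_ 2) 3)
  · linarith [hle 0, hle 1, hle 2]
  · linarith

lemma IsPolyiamond.six_mul_le_perimeter {A : Finset Tile} (hA : IsPolyiamond A) {k : ℕ}
    (hk : 1 < k) (hc : A.card = 6 * k ^ 2 - 2) : 6 * k ≤ perimeter A := by
  by_contra! h
  have h1 := hA.six_mul_card_le
  have h2 : perimeter A ≤ 6 * k - 1 := by omega
  have h3 : perimeter A ^ 2 ≤ (6 * k - 1) ^ 2 := Nat.pow_le_pow_left h2 2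
  have h4 : 1 ≤ k ^ 2 := Nat.one_le_pow _ _ (by omega)
  rw [hc] at h1
  have h5 := h1.trans (Nat.add_le_add_right h3 3)
  zify [show 2 ≤ 6 * k ^ 2 by omega, show 1 ≤ 6 * k by omega] at h5 hk
  -- Here `36k² - 12 ≤ (6k - 1)² + 3` would mean `12k ≤ 16`, which fails exactly from `k = 2` on.
  nlinarith

/-! ### Spiral-like polyiamonds -/

/-- The properties of the spiral polyiamonds that are preserved by their recursion: they fill a
hexagon without a corner up to isolated tiles inside the hexagon. -/
structure IsSpiralLike (k : ℕ) (S : Finset Tile) : Prop where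
  polyiamond : IsPolyiamond S
  subset : S ⊆ filled k
  layer_subset : layer k \ corner k ⊆ S
  isolated : ∀ t ∈ filled k, t ∉ S → ∀ d, nbr d t ∈ S
  card_eq : S.card = nSeq k

lemma card_filled_sdiff {k : ℕ} (hk : 0 < k) {S : Finset Tile} (hS : S ⊆ filled k)
    (hc : S.card = nSeq k) : (filled k \ S).card = hSeq k := by
  rw [Finset.card_sdiff_of_subset hS, card_filled hk, hc]
  have := nSeq_add_hSeq hk
  omega

/-- There are as many holes as missing tiles, so no two missing tiles can share a component; and
they lie deep enough for all their neighbours to be in `filled k`. -/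
lemma IsCentral.isSpiralLike {k : ℕ} (hk : 0 < k) {S : Finset Tile} (hS : IsCentral k S) :
    IsSpiralLike k S where
  polyiamond := hS.polyiamond
  subset := hS.subset
  layer_subset := hS.layer_subset
  isolated t ht htS d := by
    refine nbr_mem_of_numHoles (fun t => not_isBounded_tileComponent hk hS.subset) ?_ ht htS
      (nbr_mem_filled hk (mem_hexagon_of_mem_filled hS.layer_subset ht htS) d)
    rw [hS.numHoles_eq]
    exact (card_filled_sdiff hk hS.subset hS.card_eq).le
  card_eq := hS.card_eq

namespace IsSpiralLike

variable {k : ℕ} {S : Finset Tile}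

lemma numHoles_eq (h : IsSpiralLike k S) (hk : 0 < k) : numHoles S = hSeq k := by
  rw [Polyiamond.numHoles_eq (fun t => not_isBounded_tileComponent hk h.subset) h.isolated,
    card_filled_sdiff hk h.subset h.card_eq]

lemma isCentral (h : IsSpiralLike k S) (hk : 0 < k) : IsCentral k S :=
  ⟨h.polyiamond, h.subset, h.layer_subset, h.card_eq, h.numHoles_eq hk⟩

lemma isTree (h : IsSpiralLike k S) (hk : 0 < k) : (dualGraph S).IsTree := by
  refine h.polyiamond.isTree ?_
  rw [card_boundaryPairs_sdiff h.subset h.isolated, card_filled_sdiff hk h.subset h.card_eq,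
    card_boundaryPairs_filled hk, h.card_eq]
  have h1 := two_mul_nSeq_int hk
  have h2 := two_mul_hSeq k
  zify
  linarith

lemma holeArea_eq (h : IsSpiralLike k S) (hk : 0 < k) {H : Set ℂ} (hH : H ∈ holes S) :
    holeArea H = 1 := by
  rw [holes_eq (fun t => not_isBounded_tileComponent hk h.subset) h.isolated] at hH
  obtain ⟨t, _, rfl⟩ := hH
  exact holeArea_openTile t

lemma isPolyiamond_filled (h : IsSpiralLike k S) : IsPolyiamond (filled k) := by
  obtain ⟨r, hr⟩ := h.polyiamond.nonempty
  refine isPolyiamond_of_linked (h.subset hr) fun t ht => ?_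
  by_cases htS : t ∈ S
  · exact (h.polyiamond.linked hr htS).mono h.subset
  · have hn := h.isolated t ht htS 0
    exact ((h.polyiamond.linked hr hn).mono h.subset).trans
      (.of_nbr (h.subset hn) ht 0 (nbr_nbr 0 t))

lemma isLeast_outerPerimeter (h : IsSpiralLike k S) (hk : 1 < k) :
    IsLeast (perimeters (nSeq k + hSeq k)) (outerPerimeter S) := by
  have hk0 : 0 < k := by omega
  rw [outerPerimeter_eq h.subset (fun t => not_isBounded_tileComponent hk0 h.subset) h.isolated,
    nSeq_add_hSeq hk0]
  constructor
  · exact ⟨filled k, h.isPolyiamond_filled, card_filled hk0, perimeter_eq _⟩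
  · rintro p ⟨A, hA, hc, rfl⟩
    rw [card_boundaryPairs_filled hk0]
    exact hA.six_mul_le_perimeter hk hc

end IsSpiralLike

/-! ### Layers -/

lemma mem_layer_up {k : ℕ} {a b : ℤ} (hk : 0 < k) : (a, b, true) ∈ layer k ↔
    ((-k ≤ a ∧ a < k) ∧ (-k ≤ b ∧ b < k) ∧ (-k ≤ a + b ∧ a + b < k)) ∧
      (a = -k ∨ a = k - 1 ∨ b = -k ∨ b = k - 1 ∨ a + b = -k ∨ a + b = k - 1) := by
  simp only [mem_layer, mem_hexagon_up]
  omega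

lemma mem_layer_down {k : ℕ} {a b : ℤ} (hk : 0 < k) : (a, b, false) ∈ layer k ↔
    ((-k ≤ a ∧ a < k) ∧ (-k ≤ b ∧ b < k) ∧ (-k ≤ a + b + 1 ∧ a + b + 1 < k)) ∧
      (a = -k ∨ a = k - 1 ∨ b = -k ∨ b = k - 1 ∨ a + b + 1 = -k ∨ a + b + 1 = k - 1) := by
  simp only [mem_layer, mem_hexagon_down]
  omega

/-- A layer without its corner and the two tiles before this corner in the bottom row. -/
noncomputable def arc (k : ℕ) : Finset Tile :=
  layer k \ (corner k ∪ {penultimateUp k, nbr 2 (penultimateUp k)})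

lemma mem_arc_up {k : ℕ} (hk : 0 < k) {a b : ℤ} : (a, b, true) ∈ arc k ↔
    (a, b, true) ∈ layer k ∧ (b = -k → a < k - 2) := by
  simp only [arc, Finset.mem_sdiff, Finset.mem_union, mem_corner hk, penultimateUp, nbr_two_up]
  simp [mem_layer_up hk]
  omega

lemma mem_arc_down {k : ℕ} (hk : 0 < k) {a b : ℤ} : (a, b, false) ∈ arc k ↔
    (a, b, false) ∈ layer k ∧ (b = -k → a < k - 2) := by
  simp only [arc, Finset.mem_sdiff, Finset.mem_union, mem_corner hk, penultimateUp, nbr_two_up]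
  simp [mem_layer_down hk]
  omega

/-- The `p`-th tile of the row with second coordinate `c`. -/
def rowOne (c p : ℤ) : Tile := if p % 2 = 0 then (p / 2, c, true) else (p / 2, c, false)

/-- The `p`-th tile of the row with first coordinate `c`. -/
def rowZero (c p : ℤ) : Tile := if p % 2 = 0 then (c, p / 2, true) else (c, p / 2, false)

/-- The `p`-th tile of the row with third coordinate `c`. -/
def rowTwo (c p : ℤ) : Tile :=
  if p % 2 = 0 then (p / 2, -1 - c - p / 2, true) else (p / 2, -2 - c - p / 2, false)

lemma linked_of_step {A : Finset Tile} {f : ℤ → Tile} (hf : ∀ p, ∃ d, f (p + 1) = nbr d (f p))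
    {p q : ℤ} (hpq : p ≤ q) (hA : ∀ x, p ≤ x → x ≤ q → f x ∈ A) : Linked A (f p) (f q) := by
  induction q, hpq using Int.leInduction with
  | base => exact .refl _ _
  | succ q hq ih =>
    refine (ih fun x h1 h2 => hA x h1 (by omega)).tail ?_
    exact ⟨hA q hq (by omega), hA (q + 1) (by omega) le_rfl, hf q⟩

lemma rowOne_step (c p : ℤ) : ∃ d, rowOne c (p + 1) = nbr d (rowOne c p) := by
  rcases Int.emod_two_eq_zero_or_one p with h | h
  · refine ⟨2, ?_⟩
    rw [rowOne, rowOne, if_neg (by omega), if_pos h]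
    simp; omega
  · refine ⟨0, ?_⟩
    rw [rowOne, rowOne, if_pos (by omega), if_neg (by omega)]
    simp; omega

lemma rowZero_step (c p : ℤ) : ∃ d, rowZero c (p + 1) = nbr d (rowZero c p) := by
  rcases Int.emod_two_eq_zero_or_one p with h | h
  · refine ⟨2, ?_⟩
    rw [rowZero, rowZero, if_neg (by omega), if_pos h]
    simp; omega
  · refine ⟨1, ?_⟩
    rw [rowZero, rowZero, if_pos (by omega), if_neg (by omega)]
    simp; omega

lemma rowTwo_step (c p : ℤ) : ∃ d, rowTwo c (p + 1) = nbr d (rowTwo c p) := by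
  rcases Int.emod_two_eq_zero_or_one p with h | h
  · refine ⟨1, ?_⟩
    rw [rowTwo, rowTwo, if_neg (by omega), if_pos h]
    simp; omega
  · refine ⟨0, ?_⟩
    rw [rowTwo, rowTwo, if_pos (by omega), if_neg (by omega)]
    simp; omega

/-- All tiles of an arc are linked to its last tile in the bottom row. -/
lemma linked_arc {k : ℕ} (hk : 1 < k) {t : Tile} (ht : t ∈ arc k) :
    Linked (arc k) (k - 3, -k, false) t := by
  have hk0 : 0 < k := by omega
  have up : ∀ {a b : ℤ}, (a, b, true) ∈ arc k ↔ _ := fun {a b} =>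
    (mem_arc_up hk0).trans (and_congr_left' (mem_layer_up hk0))
  have down : ∀ {a b : ℤ}, (a, b, false) ∈ arc k ↔ _ := fun {a b} =>
    (mem_arc_down hk0).trans (and_congr_left' (mem_layer_down hk0))
  -- The six sides, clockwise from the bottom row; consecutive ones share a tile (`e2` to `e6`). The
  -- bottom row stops at index `2 * k - 5`, just before the penultimate up-triangle, and the last
  -- side at `-2 * k + 2`, just above the corner.
  have m1 : ∀ x : ℤ, -1 ≤ x → x ≤ 2 * k - 5 → rowOne (-k) x ∈ arc k := fun x h1 h2 => by
    rw [rowOne]; split_ifs <;> simp [up, down] <;> omega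
  have m2 : ∀ x : ℤ, -2 * k + 1 ≤ x → x ≤ -1 → rowTwo (k - 1) x ∈ arc k := fun x h1 h2 => by
    rw [rowTwo]; split_ifs <;> simp [up, down] <;> omega
  have m3 : ∀ x : ℤ, -1 ≤ x → x ≤ 2 * k - 2 → rowZero (-k) x ∈ arc k := fun x h1 h2 => by
    rw [rowZero]; split_ifs <;> simp [up, down] <;> omega
  have m4 : ∀ x : ℤ, -2 * k ≤ x → x ≤ 0 → rowOne (k - 1) x ∈ arc k := fun x h1 h2 => by
    rw [rowOne]; split_ifs <;> simp [up, down] <;> omega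
  have m5 : ∀ x : ℤ, 0 ≤ x → x ≤ 2 * k - 2 → rowTwo (-k) x ∈ arc k := fun x h1 h2 => by
    rw [rowTwo]; split_ifs <;> simp [up, down] <;> omega
  have m6 : ∀ x : ℤ, -2 * k + 2 ≤ x → x ≤ 0 → rowZero (k - 1) x ∈ arc k := fun x h1 h2 => by
    rw [rowZero]; split_ifs <;> simp [up, down] <;> omega
  have e1 : ((k - 3, -k, false) : Tile) = rowOne (-k) (2 * k - 5) := by
    rw [rowOne, if_neg (by omega)]; simp; omega
  have e2 : rowOne (-k) (-1) = rowTwo (k - 1) (-1) := by simp [rowOne, rowTwo]; omega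
  have e3 : rowTwo (k - 1) (-2 * k + 1) = rowZero (-k) (-1) := by
    rw [rowTwo, if_neg (by omega)]; simp [rowZero]; omega
  have e4 : rowZero (-k) (2 * k - 2) = rowOne (k - 1) (-2 * k) := by
    rw [rowZero, rowOne, if_pos (by omega), if_pos (by omega)]; simp; omega
  have e5 : rowOne (k - 1) 0 = rowTwo (-k) 0 := by simp [rowOne, rowTwo]; omega
  have e6 : rowTwo (-k) (2 * k - 2) = rowZero (k - 1) 0 := by
    rw [rowTwo, if_pos (by omega)]; simp [rowZero]; omega
  have l1 : ∀ x : ℤ, -1 ≤ x → x ≤ 2 * k - 5 → Linked (arc k) (k - 3, -k, false) (rowOne (-k) x) :=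
    fun x h1 h2 => e1 ▸ (linked_of_step (rowOne_step _) h2
      fun y h3 h4 => m1 y (by omega) h4).symm
  have l2 : ∀ x : ℤ, -2 * k + 1 ≤ x → x ≤ -1 →
      Linked (arc k) (k - 3, -k, false) (rowTwo (k - 1) x) := fun x h1 h2 =>
    (l1 (-1) le_rfl (by omega)).trans (e2 ▸ (linked_of_step (rowTwo_step _) h2
      fun y h3 h4 => m2 y (by omega) h4).symm)
  have l3 : ∀ x : ℤ, -1 ≤ x → x ≤ 2 * k - 2 →
      Linked (arc k) (k - 3, -k, false) (rowZero (-k) x) := fun x h1 h2 =>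
    (l2 (-2 * k + 1) le_rfl (by omega)).trans (e3 ▸ (linked_of_step (rowZero_step _) h1
      fun y h3 h4 => m3 y h3 (by omega)))
  have l4 : ∀ x : ℤ, -2 * k ≤ x → x ≤ 0 →
      Linked (arc k) (k - 3, -k, false) (rowOne (k - 1) x) := fun x h1 h2 =>
    (l3 (2 * k - 2) (by omega) le_rfl).trans (e4 ▸ (linked_of_step (rowOne_step _) h1
      fun y h3 h4 => m4 y h3 (by omega)))
  have l5 : ∀ x : ℤ, 0 ≤ x → x ≤ 2 * k - 2 →
      Linked (arc k) (k - 3, -k, false) (rowTwo (-k) x) := fun x h1 h2 =>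
    (l4 0 (by omega) le_rfl).trans (e5 ▸ (linked_of_step (rowTwo_step _) h1
      fun y h3 h4 => m5 y h3 (by omega)))
  have l6 : ∀ x : ℤ, -2 * k + 2 ≤ x → x ≤ 0 →
      Linked (arc k) (k - 3, -k, false) (rowZero (k - 1) x) := fun x h1 h2 =>
    (l5 (2 * k - 2) (by omega) le_rfl).trans (e6 ▸ (linked_of_step (rowZero_step _) h2
      fun y h3 h4 => m6 y (by omega) h4).symm)
  have key : (∃ x : ℤ, (-1 ≤ x ∧ x ≤ 2 * k - 5) ∧ t = rowOne (-k) x) ∨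
      (∃ x : ℤ, (-2 * k + 1 ≤ x ∧ x ≤ -1) ∧ t = rowTwo (k - 1) x) ∨
      (∃ x : ℤ, (-1 ≤ x ∧ x ≤ 2 * k - 2) ∧ t = rowZero (-k) x) ∨
      (∃ x : ℤ, (-2 * k ≤ x ∧ x ≤ 0) ∧ t = rowOne (k - 1) x) ∨
      (∃ x : ℤ, (0 ≤ x ∧ x ≤ 2 * k - 2) ∧ t = rowTwo (-k) x) ∨
      (∃ x : ℤ, (-2 * k + 2 ≤ x ∧ x ≤ 0) ∧ t = rowZero (k - 1) x) := by
    obtain ⟨a, b, u⟩ := t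
    have g1 : ∀ c v : ℤ, rowOne c (2 * v) = (v, c, true) := fun c v => by
      rw [rowOne, if_pos (by omega)]; simp
    have g2 : ∀ c v : ℤ, rowOne c (2 * v + 1) = (v, c, false) := fun c v => by
      rw [rowOne, if_neg (by omega)]; simp; omega
    have g3 : ∀ c v : ℤ, rowZero c (2 * v) = (c, v, true) := fun c v => by
      rw [rowZero, if_pos (by omega)]; simp
    have g4 : ∀ c v : ℤ, rowZero c (2 * v + 1) = (c, v, false) := fun c v => by
      rw [rowZero, if_neg (by omega)]; simp; omega
    have g5 : ∀ c v : ℤ, rowTwo c (2 * v) = (v, -1 - c - v, true) := fun c v => by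
      rw [rowTwo, if_pos (by omega)]; simp
    have g6 : ∀ c v : ℤ, rowTwo c (2 * v + 1) = (v, -2 - c - v, false) := fun c v => by
      rw [rowTwo, if_neg (by omega)]; simp; omega
    cases u
    · rw [down] at ht
      by_cases h1 : b = -k
      · exact Or.inl ⟨2 * a + 1, by omega, by simp [g2, h1]⟩
      by_cases h2 : a + b + 1 = -k
      · exact Or.inr (Or.inl ⟨2 * a + 1, by omega, by simp [g6]; omega⟩)
      by_cases h3 : b = k - 1
      · exact Or.inr (Or.inr (Or.inr (Or.inl ⟨2 * a + 1, by omega, by simp [g2]; omega⟩)))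
      by_cases h4 : a = -k
      · exact Or.inr (Or.inr (Or.inl ⟨2 * b + 1, by omega, by simp [g4]; omega⟩))
      by_cases h5 : a = k - 1
      · exact Or.inr (Or.inr (Or.inr (Or.inr (Or.inr ⟨2 * b + 1, by omega, by simp [g4]; omega⟩))))
      · exact Or.inr (Or.inr (Or.inr (Or.inr (Or.inl ⟨2 * a + 1, by omega, by simp [g6]; omega⟩))))
    · rw [up] at ht
      by_cases h1 : b = -k
      · exact Or.inl ⟨2 * a, by omega, by simp [g1, h1]⟩
      by_cases h3 : b = k - 1
      · exact Or.inr (Or.inr (Or.inr (Or.inl ⟨2 * a, by omega, by simp [g1]; omega⟩)))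
      by_cases h4 : a = -k
      · exact Or.inr (Or.inr (Or.inl ⟨2 * b, by omega, by simp [g3]; omega⟩))
      by_cases h5 : a = k - 1
      · exact Or.inr (Or.inr (Or.inr (Or.inr (Or.inr ⟨2 * b, by omega, by simp [g3]; omega⟩))))
      by_cases h2 : a + b = -k
      · exact Or.inr (Or.inl ⟨2 * a, by omega, by simp [g5]; omega⟩)
      · exact Or.inr (Or.inr (Or.inr (Or.inr (Or.inl ⟨2 * a, by omega, by simp [g5]; omega⟩))))
  rcases key with ⟨x, h, rfl⟩ | ⟨x, h, rfl⟩ | ⟨x, h, rfl⟩ | ⟨x, h, rfl⟩ | ⟨x, h, rfl⟩ | ⟨x, h, rfl⟩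
  exacts [l1 x h.1 h.2, l2 x h.1 h.2, l3 x h.1 h.2, l4 x h.1 h.2, l5 x h.1 h.2, l6 x h.1 h.2]

/-! ### The recursion step -/

/-- The step of the recursion that defines the spirals. -/
noncomputable def spirStep (m : ℕ) (S : Finset Tile) : Finset Tile :=
  insert (penultimateUp (m + 1))
    ((S ∪ corner m ∪ (layer (m + 1)).filter Tile.IsDown ∪
      (layer (m + 2) \ corner (m + 2))).erase (penultimateUp m))

lemma spir_add_four (S₂ S₃ : Finset Tile) (k : ℕ) :
    spir S₂ S₃ (k + 4) = spirStep (k + 2) (spir S₂ S₃ (k + 2)) := by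
  rw [spir, spirStep]

lemma mem_spirStep {m : ℕ} {S : Finset Tile} {t : Tile} : t ∈ spirStep m S ↔
    t = penultimateUp (m + 1) ∨ (t ≠ penultimateUp m ∧ (t ∈ S ∨ t ∈ corner m ∨
      (t ∈ layer (m + 1) ∧ t.IsDown) ∨ (t ∈ layer (m + 2) ∧ t ∉ corner (m + 2)))) := by
  simp [spirStep]

lemma notMem_corner_of_mem_hexagon {k : ℕ} {t : Tile} (ht : t ∈ hexagon (k - 1)) :
    t ∉ corner k := fun h => (mem_layer.1 (corner_subset_layer h)).2 ht

lemma penultimateUp_mem_layer {m : ℕ} (hm : 1 < m) : penultimateUp m ∈ layer m := by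
  rw [penultimateUp, mem_layer_up (by omega)]
  omega

lemma penultimateUp_notMem_corner {m : ℕ} (hm : 1 < m) : penultimateUp m ∉ corner m := by
  rw [mem_corner (by omega), penultimateUp]
  simp

lemma isDown_ne_penultimateUp {m : ℕ} {t : Tile} (ht : t.IsDown) : t ≠ penultimateUp m := by
  rintro rfl
  simp [Tile.IsDown, penultimateUp] at ht

lemma isDown_nbr {t : Tile} (ht : ¬ t.IsDown) (d : Fin 3) : (nbr d t).IsDown := by
  obtain ⟨a, b, u⟩ := t
  cases u
  · exact absurd rfl ht
  · fin_cases d <;> rfl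

lemma nbr_penultimateUp {m : ℕ} (d : Fin 3) (hd : d ≠ 1) (hm : 1 < m) :
    nbr d (penultimateUp m) ∈ layer m ∧ nbr d (penultimateUp m) ∉ corner m := by
  rw [mem_corner (by omega), penultimateUp]
  fin_cases d <;> simp [mem_layer_down (show 0 < m by omega)] at hd ⊢ <;> omega

lemma nbr_one_penultimateUp {m : ℕ} (hm : 1 < m) :
    nbr 1 (penultimateUp m) ∉ hexagon m ∧ nbr 1 (penultimateUp m) ∈ layer (m + 1) := by
  simp [penultimateUp, mem_layer_down, mem_hexagon_down]
  omega

namespace IsSpiralLike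

variable {m : ℕ} {S : Finset Tile}

lemma mem_of_mem_layer (h : IsSpiralLike m S) {t : Tile} (ht : t ∈ layer m)
    (hc : t ∉ corner m) : t ∈ S := h.layer_subset (Finset.mem_sdiff.2 ⟨ht, hc⟩)

lemma mem_hexagon (h : IsSpiralLike m S) {t : Tile} (ht : t ∈ S) : t ∈ hexagon m :=
  (mem_filled.1 (h.subset ht)).1

lemma penultimateUp_mem (h : IsSpiralLike m S) (hm : 1 < m) : penultimateUp m ∈ S :=
  h.mem_of_mem_layer (penultimateUp_mem_layer hm) (penultimateUp_notMem_corner hm)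

lemma card_spirStep (h : IsSpiralLike m S) (hm : 1 < m) :
    (spirStep m S).card = nSeq (m + 2) := by
  have hv := h.penultimateUp_mem hm
  have hw := penultimateUp_mem_layer (show 1 < m + 1 by omega)
  rw [spirStep, Finset.card_insert_of_notMem, Finset.card_erase_of_mem,
    Finset.card_union_of_disjoint, Finset.card_union_of_disjoint, Finset.card_union_of_disjoint,
    h.card_eq, card_corner (by omega), card_layer_down, card_layer_sdiff_corner]
  · have h1 := two_mul_nSeq_int (show 0 < m by omega)
    have h2 := two_mul_nSeq_int (show 0 < m + 2 by omega)
    have h3 : 3 * (m + 1) ^ 2 - 3 * m ^ 2 = 6 * m + 3 := by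
      rw [Nat.sub_eq_iff_eq_add (by gcongr; omega)]; ring
    have h4 : 6 * (m + 1 + 1) ^ 2 - 6 * (m + 1) ^ 2 = 12 * m + 18 := by
      rw [Nat.sub_eq_iff_eq_add (by gcongr; omega)]; ring
    rw [h3, h4]
    push_cast at h2
    -- The added pieces have `2`, `6m + 3` and `12m + 16` tiles; moving one tile changes nothing.
    have h5 : (nSeq (m + 2) : ℤ) = nSeq m + 18 * m + 21 := by linarith
    omega
  · rw [Finset.disjoint_left]
    intro t ht hc
    exact (mem_filled.1 (h.subset ht)).2 hc
  · rw [Finset.disjoint_left]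
    intro t ht hc
    have h1 := (mem_layer.1 (Finset.mem_filter.1 hc).1).2
    rw [Nat.add_sub_cancel] at h1
    rcases Finset.mem_union.1 ht with ht | ht
    · exact h1 (h.mem_hexagon ht)
    · exact h1 (corner_subset ht)
  · rw [Finset.disjoint_left]
    intro t ht hc
    apply (mem_layer.1 (Finset.mem_sdiff.1 hc).1).2
    change t ∈ hexagon (m + 1)
    simp only [Finset.mem_union, Finset.mem_filter] at ht
    rcases ht with (ht | ht) | ht
    · exact hexagon_mono (by omega) (h.mem_hexagon ht)
    · exact hexagon_mono (by omega) (corner_subset ht)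
    · exact (mem_layer.1 ht.1).1
  · simp [hv]
  · have h1 := mem_layer.1 hw
    rw [Nat.add_sub_cancel] at h1
    simp only [Finset.mem_erase, Finset.mem_union, Finset.mem_filter, Finset.mem_sdiff, not_and,
      not_or]
    refine fun _ => ⟨⟨⟨fun ht => h1.2 (h.mem_hexagon ht), fun ht => h1.2 (corner_subset ht)⟩,
      fun _ ht => isDown_ne_penultimateUp ht rfl⟩, fun ht => absurd h1.1 (mem_layer.1 ht).2⟩

lemma isolated_spirStep (h : IsSpiralLike m S) (hm : 1 < m)
    (hsub : layer (m + 2) \ corner (m + 2) ⊆ spirStep m S) (t : Tile) (ht : t ∈ filled (m + 2))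
    (htS : t ∉ spirStep m S) (d : Fin 3) : nbr d t ∈ spirStep m S := by
  have ht1 : t ∈ hexagon (m + 1) := mem_hexagon_of_mem_filled hsub ht htS
  have hnF := nbr_mem_filled (show 0 < m + 2 by omega) ht1 d
  have hout : nbr d t ∉ hexagon (m + 1) → nbr d t ∈ spirStep m S := fun hn =>
    hsub (Finset.mem_sdiff.2 ⟨mem_layer.2 ⟨(mem_filled.1 hnF).1, hn⟩, (mem_filled.1 hnF).2⟩)
  rw [mem_spirStep, not_or, not_and] at htS
  by_cases htv : t = penultimateUp m
  · subst htv
    rw [mem_spirStep]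
    refine Or.inr ⟨nbr_ne _ _, ?_⟩
    by_cases hd : d = 1
    · subst hd
      refine Or.inr (Or.inr (Or.inl ⟨(nbr_one_penultimateUp hm).2, ?_⟩))
      exact isDown_nbr (by simp [Tile.IsDown, penultimateUp]) 1
    · have := nbr_penultimateUp d hd hm
      exact Or.inl (h.mem_of_mem_layer this.1 this.2)
  have htS2 := htS.2 htv
  simp only [not_or, not_and] at htS2
  -- A tile already missing from `S`: none of its neighbours is the removed tile, since the
  -- neighbours of that tile are in `S` or outside the hexagon of side `m`.
  by_cases htm : t ∈ hexagon m
  · have hn := h.isolated t (mem_filled.2 ⟨htm, htS2.2.1⟩) htS2.1 d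
    refine mem_spirStep.2 (Or.inr ⟨fun hv => ?_, Or.inl hn⟩)
    have htd : t = nbr d (penultimateUp m) := by rw [← hv, nbr_nbr]
    by_cases hd : d = 1
    · subst hd
      exact (nbr_one_penultimateUp hm).1 (htd ▸ htm)
    · have := nbr_penultimateUp d hd hm
      exact htS2.1 (htd ▸ h.mem_of_mem_layer this.1 this.2)
  -- An up-triangle of the intermediate layer: its neighbours are down-triangles, and those lying
  -- further in belong to layer `m`, whose down-triangles are all present.
  · have htl : t ∈ layer (m + 1) := mem_layer.2 ⟨ht1, htm⟩
    have hdn := isDown_nbr (htS2.2.2.1 htl) d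
    by_cases h1 : nbr d t ∈ hexagon (m + 1)
    · refine mem_spirStep.2 (Or.inr ⟨isDown_ne_penultimateUp hdn, ?_⟩)
      by_cases h2 : nbr d t ∈ hexagon m
      · by_cases hc : nbr d t ∈ corner m
        · exact Or.inr (Or.inl hc)
        · refine Or.inl (h.mem_of_mem_layer (mem_layer.2 ⟨h2, fun h3 => htm ?_⟩) hc)
          have := nbr_mem_filled (show 0 < m by omega) h3 d
          rw [nbr_nbr] at this
          exact (mem_filled.1 this).1
      · exact Or.inr (Or.inr (Or.inl ⟨mem_layer.2 ⟨h1, h2⟩, hdn⟩))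
    · exact hout h1

lemma isPolyiamond_spirStep (h : IsSpiralLike m S) (hm : 1 < m) :
    IsPolyiamond (spirStep m S) := by
  set T := spirStep m S with hT
  have hm0 : 0 < m := by omega
  have hS : ∀ t ∈ S, t ≠ penultimateUp m → t ∈ T := fun t ht hv =>
    mem_spirStep.2 (Or.inr ⟨hv, Or.inl ht⟩)
  have hC : ∀ t ∈ corner m, t ∈ T := fun t ht => mem_spirStep.2
    (Or.inr ⟨fun hv => penultimateUp_notMem_corner hm (hv ▸ ht), Or.inr (Or.inl ht)⟩)
  have hw : penultimateUp (m + 1) ∈ T := mem_spirStep.2 (Or.inl rfl)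
  have hD : ∀ t ∈ layer (m + 1), t.IsDown → t ∈ T := fun t ht hd => mem_spirStep.2
    (Or.inr ⟨isDown_ne_penultimateUp hd, Or.inr (Or.inr (Or.inl ⟨ht, hd⟩))⟩)
  have hO : ∀ t ∈ layer (m + 2), t ∉ corner (m + 2) → t ∈ T := fun t ht hc => mem_spirStep.2
    (Or.inr ⟨fun hv => (mem_layer.1 ht).2 (hexagon_mono (by omega : m ≤ m + 2 - 1)
      (hv ▸ (mem_layer.1 (penultimateUp_mem_layer hm)).1)), Or.inr (Or.inr (Or.inr ⟨ht, hc⟩))⟩)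
  have harc : arc m ⊆ T := fun t ht => by
    simp only [arc, Finset.mem_sdiff, Finset.mem_union, Finset.mem_insert, not_or] at ht
    exact hS t (h.mem_of_mem_layer ht.1 ht.2.1) ht.2.2.1
  have harc' : arc (m + 2) ⊆ T := fun t ht => by
    simp only [arc, Finset.mem_sdiff, Finset.mem_union, not_or] at ht
    exact hO t ht.1 ht.2.1
  set L : Tile := ((m : ℤ) - 3, -(m : ℤ), false) with hLdef
  have hLarc : L ∈ arc m := by
    rw [hLdef, mem_arc_down hm0, mem_layer_down hm0]; omega
  have hLS : L ∈ S := by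
    simp only [arc, Finset.mem_sdiff, Finset.mem_union, not_or] at hLarc
    exact h.mem_of_mem_layer hLarc.1 hLarc.2.1
  have hc1 : ((m : ℤ) - 1, -(m : ℤ), true) ∈ T := hC _ ((mem_corner hm0).2 (Or.inl rfl))
  have hc2 : ((m : ℤ) - 1, -(m : ℤ), false) ∈ T := hC _ ((mem_corner hm0).2 (Or.inr rfl))
  have hR' : ((m : ℤ) - 1, -(m : ℤ) + 1, true) ∈ arc m := by
    rw [mem_arc_up hm0, mem_layer_up hm0]; omega
  -- Around the ring: the far end of the arc touches the corner, which in turn reaches the tile on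
  -- the other side of the gap (`lR`).
  have l2 : Linked T L ((m : ℤ) - 1, -(m : ℤ), false) :=
    ((linked_arc hm hR').mono harc).trans (.of_nbr (harc hR') hc2 1 (by simp))
  have l1 : Linked T L ((m : ℤ) - 1, -(m : ℤ), true) := l2.trans (.of_nbr hc2 hc1 2 (by simp))
  have hRT : nbr 2 (penultimateUp m) ∈ T :=
    hS _ (h.mem_of_mem_layer (nbr_penultimateUp 2 (by decide) hm).1
      (nbr_penultimateUp 2 (by decide) hm).2) (nbr_ne _ _)
  have lR : Linked T L (nbr 2 (penultimateUp m)) :=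
    l1.trans (.of_nbr hc1 hRT 0 (by simp [penultimateUp]; ring))
  have lS : ∀ t ∈ S, t ≠ penultimateUp m → Linked T L t := by
    intro t ht
    have hl := h.polyiamond.linked hLS ht
    clear ht
    induction hl with
    | refl => exact fun _ => .refl _ _
    | @tail x y _ hxy ih =>
      obtain ⟨hx, hy, d, rfl⟩ := hxy
      intro hv
      -- A chain through the removed tile can only leave it to `L` or to `nbr 2 (penultimateUp m)`,
      -- and both are already linked to `L`.
      by_cases hxv : x = penultimateUp m
      · subst hxv
        have hd : d ≠ 1 := by
          rintro rfl
          exact (nbr_one_penultimateUp hm).1 (h.mem_hexagon hy)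
        obtain rfl | rfl : d = 0 ∨ d = 2 := by omega
        · have : nbr 0 (penultimateUp m) = L := by simp [penultimateUp, hLdef]; ring
          rw [this]
          exact .refl _ _
        · exact lR
      · exact (ih hxv).trans (.of_nbr (hS x hx hxv) (hS _ hy hv) d rfl)
  have lC : ∀ t ∈ corner m, Linked T L t := by
    intro t ht
    rcases (mem_corner hm0).1 ht with rfl | rfl
    exacts [l1, l2]
  -- The bridge: the corner up-triangle, the down-triangle below it, the moved tile, and `L'` in the
  -- outer layer.
  have hx : ((m : ℤ) - 1, -(m : ℤ) - 1, false) ∈ T :=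
    hD _ (by rw [mem_layer_down (by omega)]; push_cast; omega) rfl
  have lw : Linked T L (penultimateUp (m + 1)) :=
    (l1.trans (.of_nbr hc1 hx 1 (by simp))).trans
      (.of_nbr hx hw 2 (by simp [penultimateUp]; omega))
  set L' : Tile := (((m + 2 : ℕ) : ℤ) - 3, -((m + 2 : ℕ) : ℤ), false) with hLdef'
  have hLarc' : L' ∈ arc (m + 2) := by
    rw [hLdef', mem_arc_down (by omega), mem_layer_down (by omega)]; omega
  have lL' : Linked T L L' :=
    lw.trans (.of_nbr hw (harc' hLarc') 1 (by simp [penultimateUp, hLdef']; omega))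
  have lO : ∀ t ∈ layer (m + 2), t ∉ corner (m + 2) → Linked T L t := by
    have hv := penultimateUp_mem_layer (show 1 < m + 2 by omega)
    have hv' := penultimateUp_notMem_corner (show 1 < m + 2 by omega)
    have lv : Linked T L (penultimateUp (m + 2)) :=
      lL'.trans (.of_nbr (harc' hLarc') (hO _ hv hv') 0 (by simp [penultimateUp, hLdef']; ring))
    intro t ht hc
    by_cases hta : t ∈ arc (m + 2)
    · exact lL'.trans ((linked_arc (by omega) hta).mono harc')
    · simp only [arc, Finset.mem_sdiff, Finset.mem_union, Finset.mem_insert,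
        Finset.mem_singleton, ht, hc, true_and, false_or, not_not] at hta
      rcases hta with rfl | rfl
      · exact lv
      · exact lv.trans (.of_nbr (hO _ hv hv') (hO _ ht hc) 2 rfl)
  have lD : ∀ t ∈ layer (m + 1), t.IsDown → Linked T L t := by
    intro t ht hd
    -- On three alternate sides of the ring the down-triangles have an edge on its outer boundary;
    -- elsewhere they face layer `m`.
    have hnbr : ∃ d, nbr d t ∉ hexagon (m + 1) ∨ nbr d t ∈ layer m := by
      obtain ⟨a, b, u⟩ := t
      obtain rfl : u = false := hd
      rw [mem_layer_down (by omega)] at ht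
      by_cases h0 : a = m
      · exact ⟨0, by simp [mem_hexagon_up, mem_layer_up hm0]; omega⟩
      by_cases h1 : b = m
      · exact ⟨1, by simp [mem_hexagon_up, mem_layer_up hm0]; omega⟩
      by_cases h2 : a + b = - m - 2
      · exact ⟨2, by simp [mem_hexagon_up, mem_layer_up hm0]; omega⟩
      by_cases h3 : a = - m - 1
      · exact ⟨0, by simp [mem_hexagon_up, mem_layer_up hm0]; omega⟩
      by_cases h4 : b = - m - 1
      · exact ⟨1, by simp [mem_hexagon_up, mem_layer_up hm0]; omega⟩
      · exact ⟨2, by simp [mem_hexagon_up, mem_layer_up hm0]; omega⟩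
    obtain ⟨d, hn | hn⟩ := hnbr
    · have hF := mem_filled.1
        (nbr_mem_filled (show 0 < m + 2 by omega) (mem_layer.1 ht).1 d)
      have hl := mem_layer.2 ⟨hF.1, hn⟩
      exact (lO _ hl hF.2).trans (.of_nbr (hO _ hl hF.2) (hD t ht hd) d (nbr_nbr d t))
    -- Only the down-triangle under the removed tile loses its support; it is adjacent to the moved
    -- tile.
    · by_cases hv : nbr d t = penultimateUp m
      · have htd : t = nbr d (penultimateUp m) := by rw [← hv, nbr_nbr]
        have hd1 : d = 1 := by
          by_contra hd1
          exact (mem_layer.1 ht).2 (htd ▸ (mem_layer.1 (nbr_penultimateUp d hd1 hm).1).1)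
        subst hd1
        exact lw.trans (.of_nbr hw (hD t ht hd) 0 (by rw [htd]; simp [penultimateUp]; omega))
      · by_cases hc : nbr d t ∈ corner m
        · exact (lC _ hc).trans (.of_nbr (hC _ hc) (hD t ht hd) d (nbr_nbr d t))
        · have hnS := h.mem_of_mem_layer hn hc
          exact (lS _ hnS hv).trans (.of_nbr (hS _ hnS hv) (hD t ht hd) d (nbr_nbr d t))
  refine isPolyiamond_of_linked (harc hLarc) fun t ht => ?_
  rcases mem_spirStep.1 ht with rfl | ⟨hv, ht | ht | ⟨ht, hd⟩ | ⟨ht, hc⟩⟩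
  exacts [lw, lS t ht hv, lC t ht, lD t ht hd, lO t ht hc]

lemma spirStep (h : IsSpiralLike m S) (hm : 1 < m) :
    IsSpiralLike (m + 2) (spirStep m S) := by
  have hlayer : layer (m + 2) \ corner (m + 2) ⊆ Polyiamond.spirStep m S := by
    intro t ht
    have ht := Finset.mem_sdiff.1 ht
    refine mem_spirStep.2 (Or.inr ⟨fun hv => (mem_layer.1 ht.1).2 ?_,
      Or.inr (Or.inr (Or.inr ht))⟩)
    exact hexagon_mono (by omega) (hv ▸ (mem_layer.1 (penultimateUp_mem_layer hm)).1)
  have hsub : Polyiamond.spirStep m S ⊆ filled (m + 2) := by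
    have key : ∀ t ∈ hexagon (m + 1), t ∈ filled (m + 2) := fun t ht =>
      mem_filled.2 ⟨hexagon_mono (by omega) ht, notMem_corner_of_mem_hexagon ht⟩
    intro t ht
    rcases mem_spirStep.1 ht with rfl | ⟨hv, ht | ht | ⟨ht, hd⟩ | ⟨ht, hc⟩⟩
    · exact key _ (mem_layer.1 (penultimateUp_mem_layer (by omega))).1
    · exact key t (hexagon_mono (by omega) (h.mem_hexagon ht))
    · exact key t (hexagon_mono (by omega) (corner_subset ht))
    · exact key t (mem_layer.1 ht).1
    · exact mem_filled.2 ⟨(mem_layer.1 ht).1, hc⟩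
  exact ⟨h.isPolyiamond_spirStep hm, hsub, hlayer, h.isolated_spirStep hm hlayer,
    h.card_spirStep hm⟩

end IsSpiralLike

lemma isSpiralLike_spir {S₂ S₃ : Finset Tile} (h₂ : IsSpiralLike 2 S₂) (h₃ : IsSpiralLike 3 S₃) :
    ∀ k, 1 < k → IsSpiralLike k (spir S₂ S₃ k)
  | 0, h => by omega
  | 1, h => by omega
  | 2, _ => by simpa [spir] using h₂
  | 3, _ => by simpa [spir] using h₃
  | k + 4, _ => by
    rw [spir_add_four]
    exact (isSpiralLike_spir h₂ h₃ (k + 2) (by omega)).spirStep (by omega)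

/-! ### The central configurations -/

lemma linked_layer_sdiff_corner {k : ℕ} (hk : 1 < k) {t : Tile} (ht : t ∈ layer k \ corner k) :
    Linked (layer k \ corner k) (k - 3, -k, false) t := by
  have hk0 : 0 < k := by omega
  have harc : arc k ⊆ layer k \ corner k := fun t ht => by
    simp only [arc, Finset.mem_sdiff, Finset.mem_union, not_or] at ht ⊢
    exact ⟨ht.1, ht.2.1⟩
  have hL : ((k : ℤ) - 3, -(k : ℤ), false) ∈ arc k := by
    rw [mem_arc_down hk0, mem_layer_down hk0]; omega
  have hv := Finset.mem_sdiff.2 ⟨penultimateUp_mem_layer hk, penultimateUp_notMem_corner hk⟩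
  have lv : Linked (layer k \ corner k) ((k : ℤ) - 3, -(k : ℤ), false) (penultimateUp k) :=
    .of_nbr (harc hL) hv 0 (by simp [penultimateUp]; ring)
  by_cases hta : t ∈ arc k
  · exact (linked_arc hk hta).mono harc
  · have h := Finset.mem_sdiff.1 ht
    simp only [arc, Finset.mem_sdiff, Finset.mem_union, Finset.mem_insert,
      Finset.mem_singleton, h.1, h.2, true_and, false_or, not_not] at hta
    rcases hta with rfl | rfl
    · exact lv
    · exact lv.trans (.of_nbr hv ht 2 rfl)

/-- A criterion for removing isolated tiles from the inside of `filled k`: the list `l` contains the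
remaining inner tiles, each of which is adjacent to the outermost layer or to a previous one. -/
lemma isSpiralLike_sdiff {k : ℕ} (hk : 1 < k) {M : Finset Tile} {l : List Tile}
    (hM : M ⊆ hexagon (k - 1)) (hcard : M.card = hSeq k) (hiso : ∀ t ∈ M, ∀ d, nbr d t ∉ M)
    (hl : ∀ t ∈ hexagon (k - 1), t ∉ M → t ∈ l)
    (hnext : ∀ t ∈ l, ∃ d, nbr d t ∉ M ∧ (nbr d t ∈ l → l.idxOf (nbr d t) < l.idxOf t)) :
    IsSpiralLike k (filled k \ M) := by
  have hk0 : 0 < k := by omega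
  have hin : ∀ t ∈ hexagon (k - 1), t ∈ filled k := fun t ht =>
    mem_filled.2 ⟨hexagon_mono (Nat.sub_le _ _) ht, notMem_corner_of_mem_hexagon ht⟩
  have hlayer : layer k \ corner k ⊆ filled k \ M := fun t ht => by
    have h := Finset.mem_sdiff.1 ht
    have h' := mem_layer.1 h.1
    exact Finset.mem_sdiff.2 ⟨mem_filled.2 ⟨h'.1, h.2⟩, fun htM => h'.2 (hM htM)⟩
  have hL : ((k : ℤ) - 3, -(k : ℤ), false) ∈ layer k \ corner k := by
    rw [Finset.mem_sdiff, mem_layer_down hk0, mem_corner hk0]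
    simp; omega
  have hout : ∀ t ∈ filled k, t ∉ hexagon (k - 1) →
      Linked (filled k \ M) (k - 3, -k, false) t := fun t ht htn => by
    have h := mem_filled.1 ht
    exact (linked_layer_sdiff_corner hk
      (Finset.mem_sdiff.2 ⟨mem_layer.2 ⟨h.1, htn⟩, h.2⟩)).mono hlayer
  have hinner : ∀ n : ℕ, ∀ t ∈ hexagon (k - 1), t ∉ M → l.idxOf t = n →
      Linked (filled k \ M) (k - 3, -k, false) t := by
    intro n
    induction n using Nat.strong_induction_on with
    | _ n ih =>
      rintro t ht htM rfl
      obtain ⟨d, hdM, hd⟩ := hnext t (hl t ht htM)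
      have hdF := nbr_mem_filled hk0 ht d
      refine Linked.trans ?_ (.of_nbr (Finset.mem_sdiff.2 ⟨hdF, hdM⟩)
        (Finset.mem_sdiff.2 ⟨hin t ht, htM⟩) d (nbr_nbr d t))
      by_cases h : nbr d t ∈ hexagon (k - 1)
      · exact ih _ (hd (hl _ h hdM)) _ h hdM rfl
      · exact hout _ hdF h
  refine ⟨isPolyiamond_of_linked (hlayer hL) fun t ht => ?_, Finset.sdiff_subset, hlayer, ?_, ?_⟩
  · obtain ⟨htF, htM⟩ := Finset.mem_sdiff.1 ht
    by_cases h : t ∈ hexagon (k - 1)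
    · exact hinner _ t h htM rfl
    · exact hout t htF h
  · intro t ht htS d
    have htM : t ∈ M := by
      by_contra htM
      exact htS (Finset.mem_sdiff.2 ⟨ht, htM⟩)
    exact Finset.mem_sdiff.2 ⟨nbr_mem_filled hk0 (hM htM) d, hiso t htM d⟩
  · rw [Finset.card_sdiff_of_subset (fun t ht => hin t (hM ht)), card_filled hk0, hcard]
    have := nSeq_add_hSeq hk0
    omega

lemma isSpiralLike_centralTwo : IsSpiralLike 2 centralTwo := by
  -- Splitting off the corner exposes `filled 2`; what remains is a finite check.
  rw [centralTwo, ← Finset.sup_eq_union, ← sdiff_sdiff]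
  refine isSpiralLike_sdiff (l := [(-1, -1, false), (-1, 0, false), (0, -1, false)]) (by norm_num)
    ?_ ?_ ?_ ?_ ?_
  all_goals decide

lemma isSpiralLike_centralThree : IsSpiralLike 3 centralThree := by
  rw [centralThree, ← Finset.sup_eq_union, ← sdiff_sdiff]
  refine isSpiralLike_sdiff (l := [(-2, -1, false), (-2, 1, false), (-1, -2, false),
    (-1, 1, false), (1, -2, false), (1, 0, true), (0, 0, false), (1, -1, true), (0, -1, false),
    (0, -1, true), (-1, -1, false), (0, -2, false), (-1, 0, true), (-2, 0, false),
    (-1, 0, false)]) (by norm_num) ?_ ?_ ?_ ?_ ?_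
  all_goals decide

end Polyiamond

theorem theorem2 :
    Polyiamond.IsCentral 2 Polyiamond.centralTwo ∧
    Polyiamond.IsCentral 3 Polyiamond.centralThree ∧
    ∀ S₂ S₃ : Finset Polyiamond.Tile,
      Polyiamond.IsCentral 2 S₂ → Polyiamond.IsCentral 3 S₃ →
      ∀ k : ℕ, 1 < k →
        Polyiamond.IsPolyiamond (Polyiamond.spir S₂ S₃ k) ∧
        (Polyiamond.spir S₂ S₃ k).card = Polyiamond.nSeq k ∧
        Polyiamond.numHoles (Polyiamond.spir S₂ S₃ k) = Polyiamond.hSeq k ∧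
        (Polyiamond.dualGraph (Polyiamond.spir S₂ S₃ k)).IsTree ∧
        (∀ H ∈ Polyiamond.holes (Polyiamond.spir S₂ S₃ k), Polyiamond.holeArea H = 1) ∧
        IsLeast (Polyiamond.perimeters (Polyiamond.nSeq k + Polyiamond.hSeq k))
          (Polyiamond.outerPerimeter (Polyiamond.spir S₂ S₃ k)) := by
  refine ⟨Polyiamond.isSpiralLike_centralTwo.isCentral (by norm_num),
    Polyiamond.isSpiralLike_centralThree.isCentral (by norm_num), fun S₂ S₃ h₂ h₃ k hk => ?_⟩
  have hk0 : 0 < k := by omega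
  have h := Polyiamond.isSpiralLike_spir (h₂.isSpiralLike (by norm_num))
    (h₃.isSpiralLike (by norm_num)) k hk
  exact ⟨h.polyiamond, h.card_eq, h.numHoles_eq hk0, h.isTree hk0,
    fun H hH => h.holeArea_eq hk0 hH, h.isLeast_outerPerimeter hk⟩
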